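/- **Definitions.** Let $S$ be a measurable space. For a class $\mathcal A$ of subsets of a set let $\Delta_{\mathcal A}(n)=\sup_{|E|=n}|\{E\cap A: A\in\mathcal A\}|$; $\mathcal A$ is a *VC class* if $\Delta_{\mathcal A}(n)$ is bounded by a polynomial in $n$, and its VC dimension is the largest $m$ with $\Delta_{\mathcal A}(m)=2^m$. A class $\mathcal G$ of functions $S\to\mathbb R$ is a *VC subgraph class* if its subgraphs $\{(x,t)\in S\times\mathbb R: t<g(x)\}$, $g\in\mathcal G$, form a VC class, whose VC dimension is denoted $V_{\mathcal G}$. The class $\mathcal G$ is *permissible* if $\mathcal G=\{f(\cdot,t):t\in T\}$, where $T$ is an analytic subset of a compact metric space and $f:S\times T\to\mathbb R$ is jointly measurable ($T$ carrying its Borel $\sigma$-algebra). For a random pair $(X,Y)$ with values in $S\times[0,1]$ and law $P$, and an i.i.d. sequence $(X_1,Y_1),(X_2,Y_2),\dots$ with law $P$, put $L(g)=\mathbb E(g(X)-Y)^2$ and $\widehat L_n(g)=\frac1n\sum_{i=1}^n(g(X_i)-Y_i)^2$, and let $L^*$ be the Bayes risk, the infimum of $L(g)$ over all measurable $g:S\to\mathbb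 R$. Let $\mathcal L_{\mathcal G}=\{(x,y)\mapsto(g(x)-y)^2: g\in\mathcal G\}$, a class of functions on $S\times[0,1]$, and let $N_1(\epsilon,\mathcal F,Q)$ be the least number of elements of $\mathcal F$ such that every element of $\mathcal F$ is at $L^1(Q)$-distance less than $\epsilon$ from one of them. **Corollary 5.4 (Structural Risk Minimization for VC subgraph classes).** There is a universal constant $K>0$ such that the following holds. Let $\mathcal G_1,\mathcal G_2,\dots$ be permissible VC subgraph classes of functions with domain $S$ and range in $[0,1]$. 1. For every $j$ with $V_{\mathcal G_j}\ge1$, every probability measure $Q$ on $S\times[0,1]$ and every $0<\epsilon<1$, $$N_1(\epsilon,\mathcal L_{\mathcal G_j},Q)\le K(2V_{\mathcal G_j})\left(\frac{16e}{\epsilon}\right)^{2V_{\mathcal G_j}}.$$ 2. For every law $P$ of $(X,Y)$, every $j$ with $V_{\mathcal G_j}\ge1$, every $n\ge1$ and every $0<\epsilon<1$, $$\mathbb P\left\{\sup_{g\in\mathcal G_j}|L(g)-\widehat L_n(g)|>\epsilon\right\}\le 8K(2V_{\mathcal G_j})\left(\frac{128e}{\epsilon}\right)^{2V_{\mathcal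 G_j}}\exp(-n\epsilon^2/128).$$ 3. Suppose that $\sum_{j=1}^\infty e^{-V_{\mathcal G_j}}<\infty$, define the complexity penalty $$r(n,j)=\sqrt{\frac{256\,V_{\mathcal G_j}\log(128e^2n)}{n}},$$ and let $(X,Y)$ be such that $\inf_j\inf_{g\in\mathcal G_j}L(g)=L^*$. For $n\ge1$ let $\hat g_{n,j}\in\mathcal G_j$ be a least squares estimator, that is, a minimizer of $\widehat L_n$ over $\mathcal G_j$ (assumed to exist), and let $g_n^*$ be a function among the $\hat g_{n,j}$, $j\ge1$, that minimizes $\widehat L_n(\hat g_{n,j})+r(n,j)$. Then $g_n^*$ is strongly consistent: $L(g_n^*)\to L^*$ almost surely as $n\to\infty$. -/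

import Mathlib

open MeasureTheory ProbabilityTheory Filter Set
open scoped ENNReal Topology unitInterval

noncomputable section

namespace SRM

universe u

/-! ### VC classes of sets -/

/-- The growth function `Δ_𝒜(n) = sup_{|E| = n} |{E ∩ A : A ∈ 𝒜}|` (always at most `2 ^ n`). -/
def growth {α : Type u} (𝒜 : Set (Set α)) (n : ℕ) : ℕ :=
  ⨆ E : {E : Finset α // E.card = n}, ((fun A => ((E : Finset α) : Set α) ∩ A) '' 𝒜).ncard

/-- A VC class of sets: the growth function is bounded by a polynomial. -/
def IsVCClass {α : Type u} (𝒜 : Set (Set α)) : Prop :=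
  ∃ p : Polynomial ℝ, ∀ n : ℕ, (growth 𝒜 n : ℝ) ≤ p.eval (n : ℝ)

/-- The VC dimension: the largest `m` with `Δ_𝒜(m) = 2 ^ m`, and `⊤` if there are arbitrarily
large such `m`. -/
def vcDim {α : Type u} (𝒜 : Set (Set α)) : ℕ∞ :=
  ⨆ m : {m : ℕ // growth 𝒜 m = 2 ^ m}, ((m : ℕ) : ℕ∞)

/-! ### VC subgraph classes of functions -/

/-- The subgraph `{(x, t) : t < f x}`. -/
def subgraph {S : Type u} (f : S → ℝ) : Set (S × ℝ) :=
  {p | p.2 < f p.1}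

/-- A VC subgraph class: the subgraphs form a VC class of sets. -/
def IsVCSubgraph {S : Type u} (F : Set (S → ℝ)) : Prop :=
  IsVCClass (subgraph '' F)

/-- The VC subgraph dimension `V_F` as a natural number. It is used for VC subgraph classes only,
whose VC dimension is finite. -/
def subgraphDim {S : Type u} (F : Set (S → ℝ)) : ℕ :=
  (vcDim (subgraph '' F)).toNat

/-! ### Measurability of a class of functions -/

/-- A permissible class: `F = {f(·, t) : t ∈ T}` with `f` jointly measurable and `T` an analytic
subset of a compact metric space `M`, with the induced Borel `σ`-algebra. (A compact metric space
has at most the cardinality of the continuum, so that `M : Type` is no restriction.) -/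
def IsPermissible {S : Type u} [MeasurableSpace S] (F : Set (S → ℝ)) : Prop :=
  ∃ (M : Type) (_ : MetricSpace M) (_ : CompactSpace M) (_ : MeasurableSpace M)
    (_ : BorelSpace M) (T : Set M) (f : S → T → ℝ),
    AnalyticSet T ∧ Measurable (fun q : S × T => f q.1 q.2) ∧ F = range (fun t x => f x t)

/-! ### Covering numbers -/

/-- The covering number `N_p(ε, F, P)`: the least cardinality of a finite `B ⊆ F` such that every
`f ∈ F` has `L^p(P)` distance `< ε` to some member of `B`; `⊤` if there is none. -/
def coveringNumber {α : Type u} [MeasurableSpace α] (p : ℝ≥0∞) (ε : ℝ) (F : Set (α → ℝ))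
    (P : Measure α) : ℕ∞ :=
  ⨅ B : {B : Finset (α → ℝ) //
      (B : Set (α → ℝ)) ⊆ F ∧ ∀ f ∈ F, ∃ b ∈ B, eLpNorm (f - b) p P < ENNReal.ofReal ε},
    ((B : Finset (α → ℝ)).card : ℕ∞)

/-! ### Risks -/

/-- The loss function `l_g(x, y) = (g x - y)²` on `S × [0,1]`. -/
def loss {S : Type u} (g : S → ℝ) : S × I → ℝ :=
  fun z => (g z.1 - (z.2 : ℝ)) ^ 2

/-- The loss class `{l_g : g ∈ F}`. -/
def lossClass {S : Type u} (F : Set (S → ℝ)) : Set (S × I → ℝ) :=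
  loss '' F

/-- The risk `L(g) = E (g(X) - Y)²`, where `P` is the law of `(X, Y)`. -/
def risk {S : Type u} [MeasurableSpace S] (P : Measure (S × I)) (g : S → ℝ) : ℝ :=
  ∫ z, loss g z ∂P

/-- The empirical risk over the first `n` points of the sequence `z`. -/
def empRisk {S : Type u} (n : ℕ) (z : ℕ → S × I) (g : S → ℝ) : ℝ :=
  (∑ i ∈ Finset.range n, loss g (z i)) / n

/-- The Bayes risk: the infimum of the risk over all measurable functions (those of infinite risk,
on which the Bochner integral would be a junk value, are left out). -/
def bayesRisk {S : Type u} [MeasurableSpace S] (P : Measure (S × I)) : ℝ :=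
  ⨅ g : {g : S → ℝ // Measurable g ∧ Integrable (loss g) P}, risk P g

/-! ### Estimators -/

/-- `g` is a least squares estimator of the class `F` for the first `n` points of `z`. -/
def IsLeastSquares {S : Type u} (F : Set (S → ℝ)) (n : ℕ) (z : ℕ → S × I) (g : S → ℝ) : Prop :=
  g ∈ F ∧ ∀ h ∈ F, empRisk n z g ≤ empRisk n z h

/-- `g` is an estimator based on structural risk minimization with penalty `r n j`: it is one of
the least squares estimators `ghat j` of the classes `G j`, and minimizes among them the structural
risk `empRisk n z (ghat j) + r n j`. -/
def IsSRMEstimator {S : Type u} (G : ℕ → Set (S → ℝ)) (r : ℕ → ℕ → ℝ) (n : ℕ) (z : ℕ → S × I)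
    (ghat : ℕ → S → ℝ) (g : S → ℝ) : Prop :=
  (∀ j, IsLeastSquares (G j) n z (ghat j)) ∧
    ∃ j, g = ghat j ∧ ∀ k, empRisk n z (ghat j) + r n j ≤ empRisk n z (ghat k) + r n k

/-- The penalty `r(n, j) = √(256 V_{G_j} log(128 e² n) / n)`. -/
def penalty {S : Type u} (G : ℕ → Set (S → ℝ)) (n j : ℕ) : ℝ :=
  √(256 * (subgraphDim (G j) : ℝ) * Real.log (128 * Real.exp 1 ^ 2 * n) / n)

/-- Strong consistency of the estimators `g n`: almost surely `L(g n) → L*`. -/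
def StronglyConsistent {S : Type u} [MeasurableSpace S] (P : Measure (S × I))
    {Ω : Type*} [MeasurableSpace Ω] (μ : Measure Ω) (g : ℕ → Ω → S → ℝ) : Prop :=
  ∀ᵐ ω ∂μ, Tendsto (fun n => risk P (g n ω)) atTop (𝓝 (bayesRisk P))

end SRM

end

/-! ### Universal measurability of analytic sets and measurable projection -/

namespace SRM

/-! The constant `K = 1` suffices: the argument yields stronger bounds, which are relaxed at the
end.

Covering. The `L¹` distance of two `[0,1]`-valued functions is at most the mass between their
subgraphs under the law of `X` times Lebesgue measure, and the squared loss is 2-Lipschitz in `g`.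
So `ε`-separated losses give `ε/2`-separated subgraphs. A random sample of about `2 log m / δ`
points distinguishes every pair among `m` sets that are `δ`-separated, while Sauer–Shelah
(`ncard_inter_image_le_sum_choose`) allows only polynomially many traces on it. Solving this
inequality for `m` gives `card_le_pow_of_separated`, and a maximal separated set is a cover.

Deviation. A ghost sample replaces `L(g)` by a second empirical mean. Pairs of an i.i.d. sample may
be swapped freely, so with the pairs fixed only random signs remain; a finite cover in their
empirical measure, Hoeffding and a union bound finish. Measurability is needed only for the event on
pairs. It is the projection of a measurable set along an analytic parameter set, hence null
measurable.

Consistency. The penalty is tuned so that `exp (-n r² / 128) = (128 e² n) ^ (-2V)`. This beats the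
covering factor and leaves `e ^ (-2V)`: half of it absorbs the prefactor `V`, the other half is
summable over the classes. Borel–Cantelli then bounds all deviations by `ε + r(n, j)`
simultaneously, and the minimizing property of the estimator gives the oracle inequality. Classes of
dimension zero have at most one member and zero penalty, and are treated separately. -/

/-- Inner approximation of the range of a continuous function on the Baire space by compact sets. -/
theorem exists_isCompact_measure_range_le {X : Type*} [TopologicalSpace X] [PolishSpace X]
    [MeasurableSpace X] [BorelSpace X] (μ : Measure X) [IsFiniteMeasure μ]
    {f : (ℕ → ℕ) → X} (hf : Continuous f) {c : ℝ≥0∞} (hc : c < μ (range f)) :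
    ∃ K ⊆ range f, IsCompact K ∧ c ≤ μ K := by
  -- the cylinder of sequences bounded by a finite list of bounds
  let C : List ℕ → Set (ℕ → ℕ) := fun l => {x | ∀ i (hi : i < l.length), x i ≤ l[i]}
  -- Bounding one more coordinate by `a` exhausts the cylinder as `a` grows, so continuity from
  -- below keeps the mass above `c` for some `a`. Iterating picks the bounds greedily.
  have hstep : ∀ l : List ℕ, c < μ (f '' C l) → ∃ a : ℕ, c < μ (f '' C (l ++ [a])) := by
    intro l hl
    have hunion : f '' C l = ⋃ a : ℕ, f '' C (l ++ [a]) := by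
      rw [← image_iUnion]
      congr 1
      ext x
      simp only [C, mem_ofPred_eq, mem_iUnion, List.length_append, List.length_singleton]
      constructor
      · intro hx
        refine ⟨x l.length, fun i hi => ?_⟩
        rcases Nat.lt_or_ge i l.length with h | h
        · rw [List.getElem_append_left h]; exact hx i h
        · obtain rfl : i = l.length := by omega
          simp
      · rintro ⟨a, hx⟩ i hi
        have := hx i (by omega)
        rwa [List.getElem_append_left hi] at this
    have hmono : Monotone fun a : ℕ => f '' C (l ++ [a]) := by
      intro a b hab
      refine image_mono fun x hx i hi => ?_
      have hi' : i < (l ++ [a]).length := by simpa using hi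
      refine (hx i hi').trans ?_
      rcases Nat.lt_or_ge i l.length with h | h
      · rw [List.getElem_append_left h, List.getElem_append_left h]
      · obtain rfl : i = l.length := by simp at hi; omega
        simpa using hab
    rw [hunion, hmono.measure_iUnion] at hl
    exact lt_iSup_iff.1 hl
  choose! a ha using hstep
  let l : ℕ → List ℕ := fun n => Nat.rec [] (fun _ l => l ++ [a l]) n
  have hlsucc : ∀ n, l (n + 1) = l n ++ [a (l n)] := fun n => rfl
  have hlen : ∀ n, (l n).length = n := by
    intro n
    induction n with
    | zero => rfl
    | succ n ih => rw [hlsucc, List.length_append, ih]; rfl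
  have hl : ∀ n, c < μ (f '' C (l n)) := by
    intro n
    induction n with
    | zero =>
      have : C (l 0) = univ := by ext x; simp [C, l]
      rwa [this, image_univ]
    | succ n ih => exact ha _ ih
  let b : ℕ → ℕ := fun n => a (l n)
  have hget : ∀ n i (hi : i < (l n).length), (l n)[i] = b i := by
    intro n
    induction n with
    | zero => intro i hi; simp [l] at hi
    | succ n ih =>
      intro i hi
      have hi' : i < (l n ++ [a (l n)]).length := hi
      change (l n ++ [a (l n)])[i] = b i
      rcases Nat.lt_or_ge i (l n).length with h | h
      · rw [List.getElem_append_left h]; exact ih i h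
      · have : i = (l n).length := by simp at hi'; omega
        subst this
        simp [b, hlen]
  have hC : ∀ n, C (l n) = {x | ∀ i < n, x i ≤ b i} := by
    intro n
    ext x
    simp only [C, mem_ofPred_eq]
    constructor
    · intro h i hi
      have := h i (by rwa [hlen])
      rwa [hget] at this
    · intro h i hi
      rw [hget]
      exact h i (by rwa [hlen] at hi)
  let B : Set (ℕ → ℕ) := Set.pi univ fun i => Iic (b i)
  have hB : IsCompact B := isCompact_univ_pi fun i => (finite_Iic (b i)).isCompact
  refine ⟨f '' B, image_subset_range _ _, hB.image hf, ?_⟩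
  have hinter : ⋂ n, closure (f '' C (l n)) ⊆ f '' B := by
    intro y hy
    by_contra hyB
    obtain ⟨U, hU, W, hW, hdisj⟩ : ∃ U ∈ 𝓝ˢ (f '' B), ∃ W ∈ 𝓝 y, Disjoint U W := by
      exact Filter.disjoint_iff.1 ((hB.image hf).disjoint_nhdsSet_nhds hyB)
    obtain ⟨O, hO, hBO, hOU⟩ := mem_nhdsSet_iff_exists.1 hU
    -- some cylinder is mapped into `O`
    have hcyl : ∃ n, C (l n) ⊆ f ⁻¹' O := by
      by_contra! hcon
      have hne : ∀ n, ∃ x ∈ C (l n), x ∉ f ⁻¹' O := fun n => not_subset.1 (hcon n)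
      choose x hxC hxO using hne
      -- Only the first `n` coordinates of `x n` are bounded; cutting off the rest moves the point
      -- into the compact `B` without changing coordinatewise limits.
      let x' : ℕ → ℕ → ℕ := fun n i => if i < n then x n i else 0
      have hx'B : ∀ n, x' n ∈ B := by
        intro n i _
        simp only [x', mem_Iic]
        split_ifs with h
        · have := hxC n
          rw [hC] at this
          exact this i h
        · exact Nat.zero_le _
      obtain ⟨z, hz, φ, hφ, hlim⟩ := hB.tendsto_subseq hx'B
      have hlim' : Tendsto (fun n => x (φ n)) atTop (𝓝 z) := by
        rw [tendsto_pi_nhds] at hlim ⊢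
        intro i
        refine (hlim i).congr' ?_
        filter_upwards [eventually_gt_atTop i] with n hn
        simp [x', hn.trans_le (hφ.id_le n)]
      have hopen : IsOpen (f ⁻¹' O) := hO.preimage hf
      have hzO : z ∈ f ⁻¹' O := hBO (mem_image_of_mem f hz)
      obtain ⟨n, hn⟩ := (hlim'.eventually (hopen.mem_nhds hzO)).exists
      exact hxO _ hn
    obtain ⟨n, hn⟩ := hcyl
    have hyn := mem_iInter.1 hy n
    obtain ⟨w, hwW, hw⟩ := mem_closure_iff_nhds.1 hyn W hW
    obtain ⟨v, hv, rfl⟩ := hw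
    exact (disjoint_left.1 hdisj) (hOU (hn hv)) hwW
  have hanti : Antitone fun n => closure (f '' C (l n)) := by
    refine antitone_nat_of_succ_le fun n => closure_mono (image_mono ?_)
    rw [hC n, hC (n + 1)]
    exact fun x hx i hi => hx i (hi.trans (Nat.lt_succ_self n))
  have hmeas : μ (⋂ n, closure (f '' C (l n))) = ⨅ n, μ (closure (f '' C (l n))) :=
    hanti.measure_iInter (fun n => isClosed_closure.measurableSet.nullMeasurableSet)
      ⟨0, measure_ne_top _ _⟩
  calc c ≤ ⨅ n, μ (closure (f '' C (l n))) :=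
        le_iInf fun n => (hl n).le.trans (measure_mono subset_closure)
    _ = μ (⋂ n, closure (f '' C (l n))) := hmeas.symm
    _ ≤ μ (f '' B) := measure_mono hinter

/-- Analytic sets are universally measurable. -/
theorem nullMeasurableSet_of_analyticSet {X : Type*} [TopologicalSpace X] [PolishSpace X]
    [MeasurableSpace X] [BorelSpace X] (μ : Measure X) [IsFiniteMeasure μ] {s : Set X}
    (hs : AnalyticSet s) : NullMeasurableSet s μ := by
  rw [AnalyticSet] at hs
  rcases hs with rfl | ⟨f, hf, rfl⟩
  · exact MeasurableSet.empty.nullMeasurableSet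
  rcases eq_or_ne (μ (range f)) 0 with h0 | h0
  · exact NullMeasurableSet.of_null h0
  obtain ⟨u, -, hu, hlim⟩ := exists_seq_strictMono_tendsto' (pos_iff_ne_zero.2 h0)
  choose K hKs hK hKu using fun n => exists_isCompact_measure_range_le μ hf (hu n).2
  have hKm : MeasurableSet (⋃ n, K n) := .iUnion fun n => (hK n).measurableSet
  have hsub : (⋃ n, K n) ⊆ range f := iUnion_subset hKs
  have hle : μ (range f) ≤ μ (⋃ n, K n) :=
    le_of_tendsto' hlim fun n => (hKu n).trans (measure_mono (subset_iUnion K n))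
  exact hKm.nullMeasurableSet.congr
    (ae_eq_of_subset_of_measure_ge hsub hle hKm.nullMeasurableSet (measure_ne_top _ _))

/-- A measurable subset of a product depends on the first coordinate only through a measurable map
to the Cantor space. -/
theorem exists_preimage_cantor {Ω Y : Type*} [MeasurableSpace Ω] [MeasurableSpace Y]
    {s : Set (Ω × Y)} (hs : MeasurableSet s) :
    ∃ φ : Ω → ℕ → Bool, Measurable φ ∧ ∃ t : Set ((ℕ → Bool) × Y), MeasurableSet t ∧
      s = Prod.map φ id ⁻¹' t := by
  classical
  rw [← generateFrom_prod] at hs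
  induction s, hs using MeasurableSpace.generateFrom_induction with
  | hC s hs _ =>
    obtain ⟨A, hA, B, hB, rfl⟩ := hs
    refine ⟨fun ω _ => decide (ω ∈ A), ?_, {x | x 0 = true} ×ˢ B, ?_, ?_⟩
    · exact measurable_pi_lambda _ fun _ => measurable_to_bool (by
        have hA' : MeasurableSet A := hA
        convert hA' using 1
        ext
        simp)
    · refine MeasurableSet.prod ?_ hB
      exact (measurable_pi_apply (X := fun _ : ℕ => Bool) 0) (measurableSet_singleton true)
    · ext ⟨ω, y⟩; simp
  | empty => exact ⟨fun _ _ => true, measurable_const, ∅, .empty, by simp⟩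
  | compl s _ ih =>
    obtain ⟨φ, hφ, t, ht, rfl⟩ := ih
    exact ⟨φ, hφ, tᶜ, ht.compl, rfl⟩
  | iUnion s _ ih =>
    choose φ hφ t ht hst using ih
    -- Countably many Cantor codes are interleaved into one by the pairing function.
    refine ⟨fun ω k => φ k.unpair.1 ω k.unpair.2, ?_,
      ⋃ n, Prod.map (fun x k => x (Nat.pair n k)) id ⁻¹' t n, ?_, ?_⟩
    · exact measurable_pi_lambda _ fun k => (measurable_pi_apply _).comp (hφ _)
    · refine .iUnion fun n => ?_
      have : Measurable (fun (x : ℕ → Bool) k => x (Nat.pair n k)) :=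
        measurable_pi_lambda _ fun k => measurable_pi_apply _
      exact (this.prodMap measurable_id) (ht n)
    · rw [preimage_iUnion]
      refine iUnion_congr fun n => ?_
      rw [hst n]
      ext ⟨ω, y⟩
      simp

/-- The projection of a measurable set along the Baire space is universally measurable. -/
theorem nullMeasurableSet_fst_image {Ω : Type*} [MeasurableSpace Ω] (μ : Measure Ω)
    [IsFiniteMeasure μ] {s : Set (Ω × (ℕ → ℕ))} (hs : MeasurableSet s) :
    NullMeasurableSet (Prod.fst '' s) μ := by
  obtain ⟨φ, hφ, t, ht, rfl⟩ := exists_preimage_cantor hs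
  -- Whether the fibre over `ω` is nonempty depends on `φ ω` alone, so the projection is pulled back
  -- from an analytic subset of the Cantor space.
  have himage : Prod.fst '' (Prod.map φ id ⁻¹' t) = φ ⁻¹' (Prod.fst '' t) := by
    ext ω
    simp
  rw [himage]
  have : PolishSpace (ℕ → Bool) := {}
  have : NullMeasurableSet (Prod.fst '' t) (μ.map φ) :=
    nullMeasurableSet_of_analyticSet _ (ht.analyticSet.image_of_continuous continuous_fst)
  exact this.preimage (hφ.measurePreserving μ).quasiMeasurePreserving

/-- Measurable projection: an existential quantifier over an analytic set of parameters keeps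
universal measurability. -/
theorem nullMeasurableSet_exists {Ω M : Type*} [MeasurableSpace Ω] (μ : Measure Ω)
    [IsFiniteMeasure μ] [TopologicalSpace M] [MeasurableSpace M] [BorelSpace M]
    {T : Set M} (hT : AnalyticSet T) {p : Ω → T → Prop}
    (hp : MeasurableSet {q : Ω × T | p q.1 q.2}) : NullMeasurableSet {ω | ∃ t, p ω t} μ := by
  rw [AnalyticSet] at hT
  rcases hT with rfl | ⟨f, hf, rfl⟩
  · simp
  have hf' : Continuous (rangeFactorization f) := hf.subtype_mk _
  have hmeas : MeasurableSet {q : Ω × (ℕ → ℕ) | p q.1 (rangeFactorization f q.2)} :=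
    (measurable_id.prodMap hf'.measurable) hp
  convert nullMeasurableSet_fst_image μ hmeas using 1
  ext ω
  simp [rangeFactorization_surjective.exists]

/-! ### The Sauer–Shelah bound -/

theorem inter_image_subset_powerset {α : Type*} (𝒜 : Set (Set α)) (E : Finset α) :
    (fun A => (E : Set α) ∩ A) '' 𝒜 ⊆ 𝒫 (E : Set α) := by
  rintro _ ⟨A, -, rfl⟩
  exact inter_subset_left

theorem ncard_inter_image_le {α : Type*} (𝒜 : Set (Set α)) (E : Finset α) :
    ((fun A => (E : Set α) ∩ A) '' 𝒜).ncard ≤ 2 ^ E.card := by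
  refine (ncard_le_ncard (inter_image_subset_powerset 𝒜 E) E.finite_toSet.finite_subsets).trans ?_
  rw [ncard_powerset _ E.finite_toSet, ncard_coe_finset]

theorem ncard_inter_image_le_growth {α : Type*} (𝒜 : Set (Set α)) (E : Finset α) :
    ((fun A => (E : Set α) ∩ A) '' 𝒜).ncard ≤ growth 𝒜 E.card := by
  -- An unbounded supremum in `ℕ` would take the default value 0.
  have hbdd : BddAbove (range fun F : {F : Finset α // F.card = E.card} =>
      ((fun A => ((F : Finset α) : Set α) ∩ A) '' 𝒜).ncard) := by
    refine ⟨2 ^ E.card, ?_⟩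
    rintro _ ⟨F, rfl⟩
    have := ncard_inter_image_le 𝒜 (F : Finset α)
    rwa [F.2] at this
  exact le_ciSup hbdd ⟨E, rfl⟩

theorem growth_le_two_pow {α : Type*} (𝒜 : Set (Set α)) (n : ℕ) : growth 𝒜 n ≤ 2 ^ n := by
  refine ciSup_le' fun E => ?_
  have := ncard_inter_image_le 𝒜 (E : Finset α)
  rwa [E.2] at this

/-- A set all of whose subsets are traced out has full growth. -/
theorem growth_eq_two_pow_of_shattered {α : Type*} {𝒜 : Set (Set α)} {E : Finset α}
    (h : ∀ U ⊆ (E : Set α), ∃ A ∈ 𝒜, (E : Set α) ∩ A = U) : growth 𝒜 E.card = 2 ^ E.card := by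
  refine (growth_le_two_pow 𝒜 _).antisymm (le_trans ?_ (ncard_inter_image_le_growth 𝒜 E))
  rw [← ncard_coe_finset E, ← ncard_powerset _ E.finite_toSet]
  exact ncard_le_ncard (fun U hU => h U hU)
    (E.finite_toSet.finite_subsets.subset (inter_image_subset_powerset 𝒜 E))

/-- The **Sauer–Shelah lemma** for the traces of a class of sets on a finite set. -/
theorem ncard_inter_image_le_sum_choose {α : Type*} {𝒜 : Set (Set α)} {d : ℕ}
    (hd : ∀ m, growth 𝒜 m = 2 ^ m → m ≤ d) (E : Finset α) :
    ((fun A => (E : Set α) ∩ A) '' 𝒜).ncard ≤ ∑ k ∈ Finset.range (d + 1), E.card.choose k := by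
  classical
  let 𝓑 : Finset (Finset α) := E.powerset.filter fun u => ∃ A ∈ 𝒜, (E : Set α) ∩ A = u
  have hcard : ((fun A => (E : Set α) ∩ A) '' 𝒜).ncard ≤ 𝓑.card := by
    have himage : (fun A => (E : Set α) ∩ A) '' 𝒜 ⊆ (fun u : Finset α => (u : Set α)) '' 𝓑 := by
      rintro _ ⟨A, hA, rfl⟩
      refine ⟨E.filter (· ∈ A), ?_, by ext; simp⟩
      simp only [𝓑, Finset.coe_filter, Finset.mem_powerset, mem_ofPred_eq]
      exact ⟨Finset.filter_subset _ _, A, hA, by ext; simp⟩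
    refine (ncard_le_ncard himage (𝓑.finite_toSet.image _)).trans ?_
    exact (ncard_image_le 𝓑.finite_toSet).trans (ncard_coe_finset 𝓑).le
  -- Pajor's form: a finite family has no more members than it shatters sets, and shattered sets
  -- have at most `d` elements.
  refine hcard.trans (𝓑.card_le_card_shatterer.trans ?_)
  have hsub : 𝓑.shatterer ⊆ (Finset.range (d + 1)).biUnion fun k => E.powersetCard k := by
    intro F hF
    rw [Finset.mem_shatterer] at hF
    have hFE : F ⊆ E := by
      obtain ⟨u, hu, hFu⟩ := hF.exists_superset
      exact hFu.trans (Finset.mem_powerset.1 (Finset.mem_filter.1 hu).1)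
    have hgrowth : growth 𝒜 F.card = 2 ^ F.card := by
      refine growth_eq_two_pow_of_shattered fun U hU => ?_
      lift U to Finset α using F.finite_toSet.subset hU
      obtain ⟨u, hu, hFu⟩ := hF (Finset.coe_subset.1 hU)
      obtain ⟨A, hA, hEA⟩ := (Finset.mem_filter.1 hu).2
      refine ⟨A, hA, ?_⟩
      rw [← hFu, Finset.coe_inter, ← hEA, ← inter_assoc,
        inter_eq_left.2 (Finset.coe_subset.2 hFE)]
    simp only [Finset.mem_biUnion, Finset.mem_range, Finset.mem_powersetCard]
    exact ⟨F.card, Nat.lt_succ_of_le (hd _ hgrowth), hFE, rfl⟩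
  refine (Finset.card_le_card hsub).trans (Finset.card_biUnion_le.trans ?_)
  simp [Finset.card_powersetCard]

/-- Weight the sum by `q ^ d` with `q = d / n ≤ 1`. Since `q ^ d ≤ q ^ k` for `k ≤ d`, the binomial
theorem bounds it by `(1 + q) ^ n ≤ e ^ d`. -/
theorem sum_choose_le_pow {n d : ℕ} (hd : 1 ≤ d) (hdn : d ≤ n) :
    (∑ k ∈ Finset.range (d + 1), (n.choose k : ℝ)) ≤ (Real.exp 1 * n / d) ^ d := by
  have hd0 : (0 : ℝ) < d := by exact_mod_cast hd
  have hn0 : (0 : ℝ) < n := hd0.trans_le (by exact_mod_cast hdn)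
  set q : ℝ := d / n with hq
  have hq0 : 0 < q := by positivity
  have hq1 : q ≤ 1 := by rw [hq, div_le_one hn0]; exact_mod_cast hdn
  have hpow : q ^ d * ∑ k ∈ Finset.range (d + 1), (n.choose k : ℝ) ≤ Real.exp 1 ^ d := by
    calc q ^ d * ∑ k ∈ Finset.range (d + 1), (n.choose k : ℝ)
        = ∑ k ∈ Finset.range (d + 1), q ^ d * (n.choose k : ℝ) := Finset.mul_sum _ _ _
      _ ≤ ∑ k ∈ Finset.range (d + 1), q ^ k * (n.choose k : ℝ) := by
          refine Finset.sum_le_sum fun k hk => ?_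
          have hk' : k ≤ d := Nat.lt_succ_iff.1 (Finset.mem_range.1 hk)
          gcongr ?_ * _
          exact pow_le_pow_of_le_one hq0.le hq1 hk'
      _ ≤ ∑ k ∈ Finset.range (n + 1), q ^ k * (n.choose k : ℝ) := by
          refine Finset.sum_le_sum_of_subset_of_nonneg ?_ fun _ _ _ => by positivity
          exact Finset.range_mono (by omega)
      _ = (q + 1) ^ n := by rw [add_pow]; simp
      _ ≤ Real.exp q ^ n := by gcongr; exact Real.add_one_le_exp q
      _ = Real.exp 1 ^ d := by
          rw [← Real.exp_nat_mul, ← Real.exp_nat_mul, hq]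
          congr 1
          field_simp
  have : (Real.exp 1 * n / d) ^ d = Real.exp 1 ^ d / q ^ d := by
    rw [← div_pow, hq]
    congr 1
    field_simp
  rw [this, le_div_iff₀ (by positivity), mul_comm]
  exact hpow

theorem exists_forall_le_of_isVCClass {α : Type*} {𝒜 : Set (Set α)} (h : IsVCClass 𝒜) :
    ∃ N : ℕ, ∀ m, growth 𝒜 m = 2 ^ m → m ≤ N := by
  obtain ⟨p, hp⟩ := h
  have hlim : Tendsto (fun n : ℕ => p.eval (n : ℝ) / 2 ^ n) atTop (𝓝 0) := by
    have : (fun n : ℕ => p.eval (n : ℝ) / 2 ^ n) = fun n : ℕ =>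
        ∑ k ∈ Finset.range (p.natDegree + 1), p.coeff k * ((n : ℝ) ^ k / 2 ^ n) := by
      ext n
      rw [Polynomial.eval_eq_sum_range, Finset.sum_div]
      exact Finset.sum_congr rfl fun k _ => by ring
    rw [this]
    have hz : (0 : ℝ) = ∑ k ∈ Finset.range (p.natDegree + 1), p.coeff k * 0 := by simp
    rw [hz]
    exact tendsto_finsetSum _ fun k _ =>
      (tendsto_pow_const_div_const_pow_of_one_lt k one_lt_two).const_mul _
  obtain ⟨N, hN⟩ := eventually_atTop.1 (hlim.eventually (gt_mem_nhds one_pos))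
  refine ⟨N, fun m hm => ?_⟩
  by_contra! hlt
  have h1 := hN m hlt.le
  rw [div_lt_one (by positivity)] at h1
  have h2 := hp m
  rw [hm] at h2
  push_cast at h2
  linarith

/-- The subgraphs of a VC subgraph class shatter no set with more than `V_F` elements. -/
theorem le_subgraphDim {S : Type*} {F : Set (S → ℝ)} (hF : IsVCSubgraph F) {m : ℕ}
    (hm : growth (subgraph '' F) m = 2 ^ m) : m ≤ subgraphDim F := by
  obtain ⟨N, hN⟩ := exists_forall_le_of_isVCClass hF
  -- `toNat` sends `⊤` to 0, so finiteness has to be settled before the dimension can serve as a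
  -- bound.
  have htop : vcDim (subgraph '' F) ≠ ⊤ := by
    refine ne_top_of_le_ne_top (ENat.natCast_ne_top N) (iSup_le fun m => ?_)
    exact_mod_cast hN m m.2
  have hle : (m : ℕ∞) ≤ vcDim (subgraph '' F) :=
    le_iSup (fun m : {m : ℕ // growth (subgraph '' F) m = 2 ^ m} => ((m : ℕ) : ℕ∞)) ⟨m, hm⟩
  rw [← ENat.natCast_toNat htop] at hle
  exact_mod_cast hle

/-- A VC subgraph class of dimension zero has at most one element. -/
theorem subsingleton_of_subgraphDim_eq_zero {S : Type*} {F : Set (S → ℝ)} (hF : IsVCSubgraph F)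
    (h0 : subgraphDim F = 0) : F.Subsingleton := by
  by_contra hns
  obtain ⟨g, hg, h, hh, hne⟩ := not_subsingleton_iff.1 hns
  -- If `g x < h x`, the point `(x, g x)` lies in the subgraph of `h` but not in that of `g`, so
  -- this singleton is shattered.
  have key : ∀ g ∈ F, ∀ h ∈ F, ∀ x, g x < h x → False := by
    intro g hg h hh x hlt
    have hgrowth : growth (subgraph '' F) ({(x, g x)} : Finset (S × ℝ)).card
        = 2 ^ ({(x, g x)} : Finset (S × ℝ)).card := by
      refine growth_eq_two_pow_of_shattered fun U hU => ?_
      rw [Finset.coe_singleton] at hU ⊢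
      rcases subset_singleton_iff_eq.1 hU with rfl | rfl
      · refine ⟨subgraph g, mem_image_of_mem _ hg, ?_⟩
        rw [singleton_inter_eq_empty]
        exact lt_irrefl (g x)
      · refine ⟨subgraph h, mem_image_of_mem _ hh, ?_⟩
        rw [inter_eq_left, singleton_subset_iff]
        exact hlt
    have := le_subgraphDim hF hgrowth
    simp [h0] at this
  refine hne (funext fun x => le_antisymm ?_ ?_)
  · exact not_lt.1 fun hlt => key h hh g hg x hlt
  · exact not_lt.1 fun hlt => key g hg h hh x hlt

/-! ### Packing numbers of VC classes -/

/-- Sampling `n` points at random separates all pairs of a `δ`-separated family, if `n` is large. -/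
theorem card_le_sum_choose_of_separated {α ι : Type*} [MeasurableSpace α] (ν : Measure α)
    [IsProbabilityMeasure ν] {𝒜 : Set (Set α)} {d : ℕ} (hd : ∀ m, growth 𝒜 m = 2 ^ m → m ≤ d)
    {s : Finset ι} {A : ι → Set α} (hA : ∀ i ∈ s, A i ∈ 𝒜) (hAm : ∀ i ∈ s, MeasurableSet (A i))
    {δ : ℝ} (hδ0 : 0 ≤ δ)
    (hsep : ∀ i ∈ s, ∀ j ∈ s, i ≠ j → ENNReal.ofReal δ ≤ ν (symmDiff (A i) (A j)))
    {n : ℕ} (hn : (s.card : ℝ) ^ 2 * Real.exp (-(n * δ)) < 1) :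
    s.card ≤ ∑ k ∈ Finset.range (d + 1), n.choose k := by
  classical
  -- The event that no sample point tells the two sets apart; its probability is at most `(1 - δ) ^
  -- n ≤ e ^ (-nδ)`.
  let bad : ι × ι → Set (Fin n → α) := fun p => univ.pi fun _ => (symmDiff (A p.1) (A p.2))ᶜ
  have hbad : ∀ p ∈ s.offDiag, Measure.pi (fun _ : Fin n => ν) (bad p) ≤
      ENNReal.ofReal (Real.exp (-(n * δ))) := by
    rintro ⟨i, j⟩ hij
    obtain ⟨hi, hj, hij⟩ := Finset.mem_offDiag.1 hij
    have hm : MeasurableSet (symmDiff (A i) (A j)) := (hAm i hi).symmDiff (hAm j hj)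
    have h1 : ν (symmDiff (A i) (A j))ᶜ ≤ ENNReal.ofReal (Real.exp (-δ)) := by
      rw [prob_compl_eq_one_sub hm]
      calc 1 - ν (symmDiff (A i) (A j)) ≤ 1 - ENNReal.ofReal δ :=
            tsub_le_tsub_left (hsep i hi j hj hij) 1
        _ = ENNReal.ofReal (1 - δ) := by rw [ENNReal.ofReal_sub _ hδ0, ENNReal.ofReal_one]
        _ ≤ ENNReal.ofReal (Real.exp (-δ)) := by
            gcongr
            have := Real.add_one_le_exp (-δ)
            linarith
    rw [Measure.pi_pi]
    simp only [Finset.prod_const, Finset.card_univ, Fintype.card_fin]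
    calc (ν (symmDiff (A i) (A j))ᶜ) ^ n ≤ ENNReal.ofReal (Real.exp (-δ)) ^ n := by gcongr
      _ = ENNReal.ofReal (Real.exp (-(n * δ))) := by
          rw [← ENNReal.ofReal_pow (Real.exp_pos _).le, ← Real.exp_nat_mul]
          congr 2
          ring
  have hunion : Measure.pi (fun _ : Fin n => ν) (⋃ p ∈ s.offDiag, bad p) < 1 := by
    calc Measure.pi (fun _ : Fin n => ν) (⋃ p ∈ s.offDiag, bad p)
        ≤ ∑ p ∈ s.offDiag, Measure.pi (fun _ : Fin n => ν) (bad p) :=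
          measure_biUnion_finset_le _ _
      _ ≤ ∑ _p ∈ s.offDiag, ENNReal.ofReal (Real.exp (-(n * δ))) := Finset.sum_le_sum hbad
      _ = s.offDiag.card * ENNReal.ofReal (Real.exp (-(n * δ))) := by
          rw [Finset.sum_const, nsmul_eq_mul]
      _ = ENNReal.ofReal (s.offDiag.card * Real.exp (-(n * δ))) := by
          rw [ENNReal.ofReal_mul (by positivity), ENNReal.ofReal_natCast]
      _ < 1 := by
          rw [ENNReal.ofReal_lt_one]
          refine lt_of_le_of_lt ?_ hn
          gcongr
          rw [Finset.offDiag_card]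
          calc ((s.card * s.card - s.card : ℕ) : ℝ) ≤ ((s.card * s.card : ℕ) : ℝ) := by
                exact_mod_cast Nat.sub_le _ _
            _ = (s.card : ℝ) ^ 2 := by push_cast; ring
  obtain ⟨x, hx⟩ : ∃ x, x ∉ ⋃ p ∈ s.offDiag, bad p := by
    by_contra! hall
    rw [eq_univ_of_forall hall, measure_univ] at hunion
    exact lt_irrefl _ hunion
  have hx' : ∀ i ∈ s, ∀ j ∈ s, i ≠ j → ∃ k, x k ∈ symmDiff (A i) (A j) := by
    intro i hi j hj hij
    by_contra! hcon
    refine hx (mem_iUnion₂.2 ⟨(i, j), Finset.mem_offDiag.2 ⟨hi, hj, hij⟩, ?_⟩)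
    exact fun k _ => hcon k
  let E : Finset α := Finset.univ.image x
  have hEn : E.card ≤ n := Finset.card_image_le.trans (by simp)
  have hinj : InjOn (fun i => (E : Set α) ∩ A i) s := by
    intro i hi j hj hij
    by_contra hne
    obtain ⟨k, hk⟩ := hx' i hi j hj hne
    have hkE : x k ∈ (E : Set α) := by simp [E]
    have hiff : x k ∈ A i ↔ x k ∈ A j := by
      have : x k ∈ (E : Set α) ∩ A i ↔ x k ∈ (E : Set α) ∩ A j := by
        rw [show (E : Set α) ∩ A i = (E : Set α) ∩ A j from hij]
      simpa [hkE] using this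
    rw [mem_symmDiff] at hk
    tauto
  calc s.card = ((fun i => (E : Set α) ∩ A i) '' s).ncard := by
        rw [hinj.ncard_image, ncard_coe_finset]
    _ ≤ ((fun A => (E : Set α) ∩ A) '' 𝒜).ncard := by
        refine ncard_le_ncard ?_
          (E.finite_toSet.finite_subsets.subset (inter_image_subset_powerset 𝒜 E))
        rintro _ ⟨i, hi, rfl⟩
        exact mem_image_of_mem _ (hA i hi)
    _ ≤ ∑ k ∈ Finset.range (d + 1), E.card.choose k := ncard_inter_image_le_sum_choose hd E
    _ ≤ ∑ k ∈ Finset.range (d + 1), n.choose k :=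
        Finset.sum_le_sum fun k _ => Nat.choose_le_choose k hEn

/-- The size of a `δ`-separated family in a VC class of dimension `d`. -/
theorem card_le_pow_of_separated {α ι : Type*} [MeasurableSpace α] (ν : Measure α)
    [IsProbabilityMeasure ν] {𝒜 : Set (Set α)} {d : ℕ} (hd : ∀ m, growth 𝒜 m = 2 ^ m → m ≤ d)
    (hd1 : 1 ≤ d) {s : Finset ι} {A : ι → Set α} (hA : ∀ i ∈ s, A i ∈ 𝒜)
    (hAm : ∀ i ∈ s, MeasurableSet (A i)) {δ : ℝ} (hδ0 : 0 < δ) (hδ1 : δ ≤ 1)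
    (hsep : ∀ i ∈ s, ∀ j ∈ s, i ≠ j → ENNReal.ofReal δ ≤ ν (symmDiff (A i) (A j))) :
    (s.card : ℝ) ≤ (4 * Real.exp 1 / δ) ^ (2 * d) := by
  have he : (1 : ℝ) ≤ Real.exp 1 := Real.one_le_exp zero_le_one
  rcases s.card.eq_zero_or_pos with hs | hs
  · rw [hs, Nat.cast_zero]
    positivity
  have hm1 : (1 : ℝ) ≤ s.card := by exact_mod_cast hs
  have hm0 : (0 : ℝ) < s.card := by linarith
  have hd0 : (0 : ℝ) < d := by exact_mod_cast hd1
  set m : ℝ := (s.card : ℝ) with hm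
  have hlog0 : 0 ≤ Real.log m := Real.log_nonneg hm1
  -- The first term makes the union bound over pairs succeed; adding `d ≥ 1` makes the inequality
  -- strict and ensures `d ≤ n`.
  set n : ℕ := ⌊2 * Real.log m / δ⌋₊ + d with hn
  have hn_gt : 2 * Real.log m / δ < n := by
    have h1 := Nat.lt_floor_add_one (2 * Real.log m / δ)
    have h2 : (1 : ℝ) ≤ d := by exact_mod_cast hd1
    push_cast [hn]
    linarith
  have hn_le : (n : ℝ) ≤ 2 * Real.log m / δ + d := by
    have h1 := Nat.floor_le (show 0 ≤ 2 * Real.log m / δ by positivity)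
    push_cast [hn]
    linarith
  have hsmall : m ^ 2 * Real.exp (-(n * δ)) < 1 := by
    rw [div_lt_iff₀ hδ0] at hn_gt
    calc m ^ 2 * Real.exp (-(n * δ)) = Real.exp (2 * Real.log m - n * δ) := by
          rw [sub_eq_add_neg, Real.exp_add, two_mul, Real.exp_add, Real.exp_log hm0, sq]
      _ < 1 := Real.exp_lt_one_iff.2 (by linarith)
  have hcard := card_le_sum_choose_of_separated ν hd hA hAm hδ0.le hsep hsmall
  have hcard' : m ≤ (Real.exp 1 * n / d) ^ d := by
    refine le_trans ?_ (sum_choose_le_pow hd1 (Nat.le_add_left d _))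
    rw [hm]
    exact_mod_cast hcard
  -- The bound on `m` involves `log m` through `n`. With `y = m ^ (1/(2d))`, `log m ≤ 2d(y - 1)`
  -- makes it linear in `y`: `y ^ (2d) ≤ (4e/δ) ^ d * y ^ d`. Cancel `y ^ d` and square.
  set y : ℝ := m ^ ((1 : ℝ) / (2 * d)) with hy
  have hy1 : 1 ≤ y := Real.one_le_rpow hm1 (by positivity)
  have hy0 : 0 < y := by linarith
  have hym : y ^ (2 * d) = m := by
    rw [hy, ← Real.rpow_natCast, ← Real.rpow_mul hm0.le]
    push_cast
    rw [one_div_mul_cancel (by positivity), Real.rpow_one]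
  have hlog : Real.log m ≤ 2 * d * (y - 1) := by
    rw [← hym, Real.log_pow]
    push_cast
    gcongr
    exact Real.log_le_sub_one_of_pos hy0
  have hbase : Real.exp 1 * n / d ≤ 4 * Real.exp 1 / δ * y := by
    have h1 : (n : ℝ) ≤ d * (4 * y / δ) := by
      calc (n : ℝ) ≤ 2 * Real.log m / δ + d := hn_le
        _ ≤ 2 * (2 * d * (y - 1)) / δ + d := by gcongr
        _ = d * (4 * y / δ) - d * (4 / δ - 1) := by field_simp; ring
        _ ≤ d * (4 * y / δ) := by
            have : 1 ≤ 4 / δ := by rw [le_div_iff₀ hδ0]; linarith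
            have : 0 ≤ d * (4 / δ - 1) := mul_nonneg hd0.le (by linarith)
            linarith
    calc Real.exp 1 * n / d ≤ Real.exp 1 * (d * (4 * y / δ)) / d := by gcongr
      _ = 4 * Real.exp 1 / δ * y := by field_simp
  have hyd : y ^ d ≤ (4 * Real.exp 1 / δ) ^ d := by
    have h1 : y ^ d * y ^ d ≤ (4 * Real.exp 1 / δ) ^ d * y ^ d := by
      calc y ^ d * y ^ d = m := by rw [← pow_add, ← two_mul, hym]
        _ ≤ (Real.exp 1 * n / d) ^ d := hcard'
        _ ≤ (4 * Real.exp 1 / δ * y) ^ d := by gcongr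
        _ = (4 * Real.exp 1 / δ) ^ d * y ^ d := mul_pow _ _ _
    exact le_of_mul_le_mul_right h1 (by positivity)
  calc m = (y ^ d) ^ 2 := by rw [← pow_mul, mul_comm, hym]
    _ ≤ ((4 * Real.exp 1 / δ) ^ d) ^ 2 := by gcongr
    _ = (4 * Real.exp 1 / δ) ^ (2 * d) := by rw [← pow_mul, mul_comm d 2]

/-! ### Covering numbers of the loss classes -/

theorem measurableSet_subgraph {S : Type*} [MeasurableSpace S] {g : S → ℝ} (hg : Measurable g) :
    MeasurableSet (subgraph g) :=
  measurableSet_lt measurable_snd (hg.comp measurable_fst)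

/-- The `L¹` distance of two functions is at most the measure between their graphs. -/
theorem lintegral_le_measure_symmDiff_subgraph {S : Type*} [MeasurableSpace S] (Q : Measure S)
    [SFinite Q] {g h : S → ℝ} (hg : Measurable g) (hh : Measurable h)
    (hg1 : ∀ x, g x ∈ Icc (0 : ℝ) 1) (hh1 : ∀ x, h x ∈ Icc (0 : ℝ) 1) :
    ∫⁻ x, ENNReal.ofReal |g x - h x| ∂Q ≤
      (Q.prod (volume.restrict (Icc (0 : ℝ) 1))) (symmDiff (subgraph g) (subgraph h)) := by
  rw [Measure.prod_apply ((measurableSet_subgraph hg).symmDiff (measurableSet_subgraph hh))]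
  refine lintegral_mono fun x => ?_
  have hsub : Ico (min (g x) (h x)) (max (g x) (h x)) ⊆
      Prod.mk x ⁻¹' symmDiff (subgraph g) (subgraph h) := by
    rintro t ⟨ht1, ht2⟩
    rw [mem_preimage, mem_symmDiff]
    change t < g x ∧ ¬ t < h x ∨ t < h x ∧ ¬ t < g x
    rcases lt_max_iff.1 ht2 with h1 | h1 <;> rcases min_le_iff.1 ht1 with h2 | h2
    · exact absurd h1 (not_lt.2 h2)
    · exact Or.inl ⟨h1, not_lt.2 h2⟩
    · exact Or.inr ⟨h1, not_lt.2 h2⟩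
    · exact absurd h1 (not_lt.2 h2)
  calc ENNReal.ofReal |g x - h x| = volume (Ico (min (g x) (h x)) (max (g x) (h x))) := by
        rw [Real.volume_Ico, max_sub_min_eq_abs, abs_sub_comm]
    _ = (volume.restrict (Icc (0 : ℝ) 1)) (Ico (min (g x) (h x)) (max (g x) (h x))) := by
        rw [Measure.restrict_eq_self]
        rintro t ⟨ht1, ht2⟩
        exact ⟨(le_min (hg1 x).1 (hh1 x).1).trans ht1, ht2.le.trans (max_le (hg1 x).2 (hh1 x).2)⟩
    _ ≤ _ := measure_mono hsub

theorem measurable_loss {S : Type*} [MeasurableSpace S] {g : S → ℝ} (hg : Measurable g) :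
    Measurable (loss g) := by
  unfold loss
  fun_prop

theorem loss_mem_Icc {S : Type*} {g : S → ℝ} (hg : ∀ x, g x ∈ Icc (0 : ℝ) 1) (z : S × I) :
    loss g z ∈ Icc (0 : ℝ) 1 := by
  have h1 := hg z.1
  have h2 := z.2.2
  refine ⟨sq_nonneg _, ?_⟩
  rw [loss, sq_le_one_iff_abs_le_one, abs_le]
  constructor <;> linarith [h1.1, h1.2, h2.1, h2.2]

theorem abs_loss_sub_le {S : Type*} {g h : S → ℝ} (hg : ∀ x, g x ∈ Icc (0 : ℝ) 1)
    (hh : ∀ x, h x ∈ Icc (0 : ℝ) 1) (z : S × I) :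
    |loss g z - loss h z| ≤ 2 * |g z.1 - h z.1| := by
  have h1 := hg z.1
  have h2 := hh z.1
  have h3 := z.2.2
  have : loss g z - loss h z = (g z.1 + h z.1 - 2 * z.2) * (g z.1 - h z.1) := by
    simp only [loss]; ring
  rw [this, abs_mul]
  gcongr
  rw [abs_le]
  constructor <;> linarith [h1.1, h1.2, h2.1, h2.2, h3.1, h3.2]

theorem eLpNorm_loss_sub_le {S : Type*} [MeasurableSpace S] (Q : Measure (S × I)) {g h : S → ℝ}
    (hg : Measurable g) (hh : Measurable h) (hg1 : ∀ x, g x ∈ Icc (0 : ℝ) 1)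
    (hh1 : ∀ x, h x ∈ Icc (0 : ℝ) 1) :
    eLpNorm (loss g - loss h) 1 Q ≤ 2 * ∫⁻ x, ENNReal.ofReal |g x - h x| ∂(Q.map Prod.fst) := by
  have hm : Measurable fun x => ENNReal.ofReal |g x - h x| := by fun_prop
  rw [eLpNorm_one_eq_lintegral_enorm, lintegral_map hm measurable_fst,
    ← lintegral_const_mul _ (by fun_prop)]
  refine lintegral_mono fun z => ?_
  rw [Real.enorm_eq_ofReal_abs, show (2 : ℝ≥0∞) = ENNReal.ofReal 2 by simp,
    ← ENNReal.ofReal_mul zero_le_two]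
  exact ENNReal.ofReal_le_ofReal (abs_loss_sub_le hg1 hh1 z)

/-- Finite covers from a bound on the size of separated sets. -/
theorem exists_cover_of_forall_separated_card_le {α : Type*} {F : Set α} {D : α → α → ℝ≥0∞}
    (hD : ∀ f, D f f = 0) (hsymm : ∀ f g, D f g = D g f) {ε : ℝ≥0∞} (hε : 0 < ε) {N : ℝ}
    (hN : ∀ B : Finset α, (B : Set α) ⊆ F → (∀ b ∈ B, ∀ c ∈ B, b ≠ c → ε ≤ D b c) →
      (B.card : ℝ) ≤ N) :
    ∃ B : Finset α, (B : Set α) ⊆ F ∧ (B.card : ℝ) ≤ N ∧ ∀ f ∈ F, ∃ b ∈ B, D f b < ε := by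
  classical
  -- A separated set of maximal cardinality is a cover: an uncovered point could be added to it.
  let P : Finset α → Prop := fun B => (B : Set α) ⊆ F ∧ ∀ b ∈ B, ∀ c ∈ B, b ≠ c → ε ≤ D b c
  let C : Set ℕ := {n | ∃ B, P B ∧ B.card = n}
  have hC : C.Nonempty := ⟨0, ∅, ⟨by simp, by simp⟩, rfl⟩
  have hbdd : BddAbove C := by
    refine ⟨⌊N⌋₊, ?_⟩
    rintro _ ⟨B, hB, rfl⟩
    exact Nat.le_floor (hN B hB.1 hB.2)
  obtain ⟨B, hB, hcard⟩ := Nat.sSup_mem hC hbdd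
  refine ⟨B, hB.1, hN B hB.1 hB.2, fun f hf => ?_⟩
  by_contra! hcon
  have hfB : f ∉ B := fun hfB => by
    have := hcon f hfB
    rw [hD] at this
    exact absurd hε (not_lt.2 this)
  have hP : P (insert f B) := by
    refine ⟨?_, ?_⟩
    · rw [Finset.coe_insert]
      exact insert_subset hf hB.1
    · intro b hb c hc hbc
      rw [Finset.mem_insert] at hb hc
      rcases hb with rfl | hb <;> rcases hc with rfl | hc
      · exact absurd rfl hbc
      · exact hcon c hc
      · rw [hsymm]; exact hcon b hb
      · exact hB.2 b hb c hc hbc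
  have := le_csSup hbdd ⟨_, hP, rfl⟩
  rw [Finset.card_insert_of_notMem hfB, hcard] at this
  omega

/-- Covers of the loss class of a VC subgraph class of positive dimension. -/
theorem exists_cover_lossClass {S : Type*} [MeasurableSpace S] {F : Set (S → ℝ)}
    (hF1 : ∀ g ∈ F, ∀ x, g x ∈ Icc (0 : ℝ) 1) (hFm : ∀ g ∈ F, Measurable g)
    (hF : IsVCSubgraph F) (hV : 1 ≤ subgraphDim F) (Q : Measure (S × I)) [IsProbabilityMeasure Q]
    {ε : ℝ} (hε0 : 0 < ε) (hε1 : ε < 1) :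
    ∃ B : Finset (S × I → ℝ), (B : Set (S × I → ℝ)) ⊆ lossClass F ∧
      (B.card : ℝ) ≤ (8 * Real.exp 1 / ε) ^ (2 * subgraphDim F) ∧
      ∀ f ∈ lossClass F, ∃ b ∈ B, eLpNorm (f - b) 1 Q < ENNReal.ofReal ε := by
  refine exists_cover_of_forall_separated_card_le (D := fun f g => eLpNorm (f - g) 1 Q)
    (fun f => by simp) (fun f g => eLpNorm_sub_comm f g 1 Q) (ENNReal.ofReal_pos.2 hε0)
    fun B hBF hsep => ?_
  have hinv : ∀ b ∈ B, ∃ g ∈ F, loss g = b := fun b hb => hBF hb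
  choose! g hgF hgb using hinv
  have : IsProbabilityMeasure (Q.map Prod.fst) :=
    Measure.isProbabilityMeasure_map measurable_fst.aemeasurable
  have : IsProbabilityMeasure (volume.restrict (Icc (0 : ℝ) 1)) := ⟨by simp⟩
  have hmain := card_le_pow_of_separated
    ((Q.map Prod.fst).prod (volume.restrict (Icc (0 : ℝ) 1)))
    (𝒜 := subgraph '' F) (fun m hm => le_subgraphDim hF hm) hV (s := B)
    (A := fun b => subgraph (g b)) (δ := ε / 2) (fun b hb => mem_image_of_mem _ (hgF b hb))
    (fun b hb => measurableSet_subgraph (hFm _ (hgF b hb))) (by positivity) (by linarith) ?_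
  · refine hmain.trans (le_of_eq ?_)
    congr 1
    field_simp
    norm_num
  · intro b hb c hc hbc
    refine le_trans ?_ (lintegral_le_measure_symmDiff_subgraph _ (hFm _ (hgF b hb))
      (hFm _ (hgF c hc)) (hF1 _ (hgF b hb)) (hF1 _ (hgF c hc)))
    have h1 := hsep b hb c hc hbc
    have h2 := eLpNorm_loss_sub_le Q (hFm _ (hgF b hb))
      (hFm _ (hgF c hc)) (hF1 _ (hgF b hb)) (hF1 _ (hgF c hc))
    rw [hgb b hb, hgb c hc] at h2
    have h3 := h1.trans h2
    rw [ENNReal.ofReal_div_of_pos two_pos]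
    refine ENNReal.div_le_of_le_mul ?_
    rw [mul_comm]
    simpa using h3

/-! ### Hoeffding's inequality for random signs -/

/-- The sign coded by a Boolean. -/
noncomputable def boolSign (b : Bool) : ℝ := if b then -1 else 1

theorem sum_exp_boolSign_le (t a : ℝ) (ha : |a| ≤ 1) :
    ∑ b : Bool, Real.exp (t * (boolSign b * a)) ≤ 2 * Real.exp (t ^ 2 / 2) := by
  have h1 : ∑ b : Bool, Real.exp (t * (boolSign b * a)) = 2 * Real.cosh (t * a) := by
    rw [Fintype.sum_bool, Real.cosh_eq]
    simp only [boolSign, if_true, Bool.false_eq_true, if_false]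
    rw [show t * (-1 * a) = -(t * a) by ring, one_mul]
    ring
  have h2 : a ^ 2 ≤ 1 := (sq_le_one_iff_abs_le_one a).2 ha
  rw [h1]
  gcongr
  refine (Real.cosh_le_exp_half_sq _).trans (Real.exp_le_exp.2 ?_)
  rw [mul_pow]
  gcongr
  exact mul_le_of_le_one_right (sq_nonneg t) h2

/-- Chernoff's bound, with the exponential parameter equal to the threshold `t`, which optimizes
`-nt² + nt²/2`. Summing over all sign vectors factorizes over coordinates. -/
theorem card_le_sum_boolSign {n : ℕ} {a : Fin n → ℝ} (ha : ∀ i, |a i| ≤ 1) {t : ℝ} (ht : 0 ≤ t) :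
    ((Finset.univ.filter fun τ : Fin n → Bool => n * t ≤ ∑ i, boolSign (τ i) * a i).card : ℝ) ≤
      2 ^ n * Real.exp (-(n * t ^ 2 / 2)) := by
  calc ((Finset.univ.filter fun τ : Fin n → Bool => n * t ≤ ∑ i, boolSign (τ i) * a i).card : ℝ)
      = ∑ _τ ∈ Finset.univ.filter (fun τ : Fin n → Bool => n * t ≤ ∑ i, boolSign (τ i) * a i),
          (1 : ℝ) := by simp
    _ ≤ ∑ τ ∈ Finset.univ.filter (fun τ : Fin n → Bool => n * t ≤ ∑ i, boolSign (τ i) * a i),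
          Real.exp (t * (∑ i, boolSign (τ i) * a i - n * t)) := by
        refine Finset.sum_le_sum fun τ hτ => Real.one_le_exp ?_
        exact mul_nonneg ht (sub_nonneg.2 (Finset.mem_filter.1 hτ).2)
    _ ≤ ∑ τ : Fin n → Bool, Real.exp (t * (∑ i, boolSign (τ i) * a i - n * t)) :=
        Finset.sum_le_sum_of_subset_of_nonneg (Finset.filter_subset _ _)
          fun _ _ _ => (Real.exp_pos _).le
    _ = Real.exp (-(n * t ^ 2)) * ∑ τ : Fin n → Bool,
          ∏ i, Real.exp (t * (boolSign (τ i) * a i)) := by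
        rw [Finset.mul_sum]
        refine Finset.sum_congr rfl fun τ _ => ?_
        rw [← Real.exp_sum, ← Real.exp_add, ← Finset.mul_sum]
        congr 1
        ring
    _ = Real.exp (-(n * t ^ 2)) * ∏ i, ∑ b : Bool, Real.exp (t * (boolSign b * a i)) := by
        rw [Finset.prod_univ_sum, Fintype.piFinset_univ]
    _ ≤ Real.exp (-(n * t ^ 2)) * ∏ _i : Fin n, (2 * Real.exp (t ^ 2 / 2)) := by
        gcongr with i
        exact sum_exp_boolSign_le t (a i) (ha i)
    _ = 2 ^ n * Real.exp (-(n * t ^ 2 / 2)) := by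
        rw [Finset.prod_const, Finset.card_univ, Fintype.card_fin, mul_pow, ← Real.exp_nat_mul,
          mul_left_comm, ← Real.exp_add]
        congr 2
        ring

/-- **Hoeffding's inequality** for signed sums, as a count of sign vectors. -/
theorem card_le_abs_sum_boolSign {n : ℕ} {a : Fin n → ℝ} (ha : ∀ i, |a i| ≤ 1) {t : ℝ}
    (ht : 0 ≤ t) :
    ((Finset.univ.filter fun τ : Fin n → Bool => n * t ≤ |∑ i, boolSign (τ i) * a i|).card : ℝ) ≤
      2 * (2 ^ n * Real.exp (-(n * t ^ 2 / 2))) := by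
  classical
  have h1 := card_le_sum_boolSign ha ht
  have h2 := card_le_sum_boolSign (a := fun i => -a i) (by simpa using ha) ht
  have hsub : (Finset.univ.filter fun τ : Fin n → Bool => n * t ≤ |∑ i, boolSign (τ i) * a i|) ⊆
      (Finset.univ.filter fun τ : Fin n → Bool => n * t ≤ ∑ i, boolSign (τ i) * a i) ∪
      (Finset.univ.filter fun τ : Fin n → Bool => n * t ≤ ∑ i, boolSign (τ i) * -a i) := by
    intro τ hτ
    have := (Finset.mem_filter.1 hτ).2
    simp only [Finset.mem_union, Finset.mem_filter, Finset.mem_univ, true_and, mul_neg,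
      Finset.sum_neg_distrib]
    exact le_abs.1 this
  have h3 := (Finset.card_le_card hsub).trans (Finset.card_union_le _ _)
  have h4 := (Nat.cast_le (α := ℝ)).2 h3
  push_cast at h4
  linarith

/-! ### Symmetrization -/

/-- Exchange the two members of the pairs selected by `τ`. -/
def swapPairs {X : Type*} {n : ℕ} (τ : Fin n → Bool) (w : Fin n → X × X) : Fin n → X × X :=
  fun i => if τ i then (w i).swap else w i

theorem measurePreserving_swapPairs {X : Type*} [MeasurableSpace X] (P : Measure X)
    [IsProbabilityMeasure P] {n : ℕ} (τ : Fin n → Bool) :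
    MeasurePreserving (swapPairs τ) (Measure.pi fun _ : Fin n => P.prod P)
      (Measure.pi fun _ : Fin n => P.prod P) := by
  refine measurePreserving_pi (fun _ => P.prod P) (fun _ => P.prod P)
    (f := fun i p => if τ i then p.swap else p) fun i => ?_
  cases τ i
  · exact MeasurePreserving.id _
  · simpa using Measure.measurePreserving_swap

theorem sum_swapPairs {X : Type*} {n : ℕ} (τ : Fin n → Bool) (w : Fin n → X × X) (f : X → ℝ) :
    ∑ i, (f (swapPairs τ w i).1 - f (swapPairs τ w i).2) =
      ∑ i, boolSign (τ i) * (f (w i).1 - f (w i).2) := by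
  refine Finset.sum_congr rfl fun i _ => ?_
  cases h : τ i <;> simp [swapPairs, boolSign, h]

/-- The empirical measure of the points in `n` pairs. -/
noncomputable def pairsEmpirical {X : Type*} [MeasurableSpace X] {n : ℕ} (w : Fin n → X × X) : Measure X :=
  (2 * n : ℝ≥0∞)⁻¹ • ∑ i, (Measure.dirac (w i).1 + Measure.dirac (w i).2)

theorem isProbabilityMeasure_pairsEmpirical {X : Type*} [MeasurableSpace X] {n : ℕ} (hn : 1 ≤ n)
    (w : Fin n → X × X) : IsProbabilityMeasure (pairsEmpirical w) := by
  refine ⟨?_⟩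
  have hn0 : (n : ℝ≥0∞) ≠ 0 := by exact_mod_cast (show n ≠ 0 by omega)
  rw [pairsEmpirical, Measure.smul_apply, Measure.finsetSum_apply]
  simp only [Measure.add_apply, measure_univ, one_add_one_eq_two, Finset.sum_const,
    Finset.card_univ, Fintype.card_fin, nsmul_eq_mul, smul_eq_mul]
  rw [mul_comm (n : ℝ≥0∞) 2]
  exact ENNReal.inv_mul_cancel (mul_ne_zero two_ne_zero hn0)
    (ENNReal.mul_ne_top ENNReal.ofNat_ne_top (ENNReal.natCast_ne_top n))

theorem sum_abs_lt_of_eLpNorm_pairsEmpirical_lt {X : Type*} [MeasurableSpace X] {n : ℕ}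
    (hn : 1 ≤ n) (w : Fin n → X × X) {f : X → ℝ} (hf : Measurable f) {δ : ℝ}
    (h : eLpNorm f 1 (pairsEmpirical w) < ENNReal.ofReal δ) :
    ∑ i, (|f (w i).1| + |f (w i).2|) < 2 * n * δ := by
  have hn0 : (0 : ℝ) < n := by exact_mod_cast hn
  have hm : Measurable fun x => ‖f x‖ₑ := hf.enorm
  have hnorm : eLpNorm f 1 (pairsEmpirical w) =
      ENNReal.ofReal ((2 * n : ℝ)⁻¹ * ∑ i, (|f (w i).1| + |f (w i).2|)) := by
    rw [eLpNorm_one_eq_lintegral_enorm, pairsEmpirical, lintegral_smul_measure,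
      lintegral_finsetSum_measure, ENNReal.ofReal_mul (by positivity),
      ENNReal.ofReal_inv_of_pos (by positivity), ENNReal.ofReal_mul zero_le_two,
      ENNReal.ofReal_sum_of_nonneg (fun i _ => by positivity), smul_eq_mul]
    simp only [ENNReal.ofReal_natCast, ENNReal.ofReal_ofNat]
    congr 1
    refine Finset.sum_congr rfl fun i _ => ?_
    rw [lintegral_add_measure, lintegral_dirac' _ hm, lintegral_dirac' _ hm,
      ENNReal.ofReal_add (abs_nonneg _) (abs_nonneg _), Real.enorm_eq_ofReal_abs,
      Real.enorm_eq_ofReal_abs]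
  rw [hnorm, ENNReal.ofReal_lt_ofReal_iff_of_nonneg (by positivity),
    inv_mul_lt_iff₀ (by positivity)] at h
  exact h

/-- Few sign vectors yield a large deviation between the two halves of the sample. -/
theorem card_exists_lt_abs_sum_swapPairs_le {X : Type*} [MeasurableSpace X] {F : Set (X → ℝ)}
    (hF1 : ∀ f ∈ F, ∀ x, f x ∈ Icc (0 : ℝ) 1) (hFm : ∀ f ∈ F, Measurable f) {ε N : ℝ}
    (hε : 0 < ε) {n : ℕ} (hn : 1 ≤ n) (w : Fin n → X × X) {B : Finset (X → ℝ)}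
    (hBF : (B : Set (X → ℝ)) ⊆ F) (hBN : (B.card : ℝ) ≤ N)
    (hB : ∀ f ∈ F, ∃ b ∈ B, eLpNorm (f - b) 1 (pairsEmpirical w) < ENNReal.ofReal (ε / 8))
    [DecidablePred fun τ : Fin n → Bool =>
      ∃ f ∈ F, n * ε / 2 < |∑ i, (f (swapPairs τ w i).1 - f (swapPairs τ w i).2)|] :
    ((Finset.univ.filter fun τ : Fin n → Bool =>
      ∃ f ∈ F, n * ε / 2 < |∑ i, (f (swapPairs τ w i).1 - f (swapPairs τ w i).2)|).card : ℝ) ≤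
      2 ^ n * (2 * N * Real.exp (-(n * ε ^ 2 / 32))) := by
  classical
  -- One cover, chosen for the unswapped `w`, serves every `τ`. Passing from `f` to `b` costs at
  -- most `2n · ε/8`, leaving the threshold `n · ε/4`.
  have hsub : (Finset.univ.filter fun τ : Fin n → Bool =>
      ∃ f ∈ F, n * ε / 2 < |∑ i, (f (swapPairs τ w i).1 - f (swapPairs τ w i).2)|) ⊆
      B.biUnion fun b => Finset.univ.filter fun τ : Fin n → Bool =>
        n * (ε / 4) ≤ |∑ i, boolSign (τ i) * (b (w i).1 - b (w i).2)| := by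
    intro τ hτ
    obtain ⟨f, hf, hlt⟩ := (Finset.mem_filter.1 hτ).2
    obtain ⟨b, hb, hfb⟩ := hB f hf
    simp only [Finset.mem_biUnion, Finset.mem_filter, Finset.mem_univ, true_and]
    refine ⟨b, hb, ?_⟩
    have h1 := sum_abs_lt_of_eLpNorm_pairsEmpirical_lt hn w
      ((hFm f hf).sub (hFm b (hBF hb))) hfb
    rw [sum_swapPairs] at hlt
    have h2 : |∑ i, boolSign (τ i) * (f (w i).1 - f (w i).2) -
        ∑ i, boolSign (τ i) * (b (w i).1 - b (w i).2)| ≤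
        ∑ i, (|(f - b) (w i).1| + |(f - b) (w i).2|) := by
      rw [← Finset.sum_sub_distrib]
      refine (Finset.abs_sum_le_sum_abs _ _).trans (Finset.sum_le_sum fun i _ => ?_)
      rw [← mul_sub, abs_mul, show |boolSign (τ i)| = 1 by cases τ i <;> simp [boolSign], one_mul]
      refine le_trans (le_of_eq ?_) (abs_sub _ _)
      congr 1
      simp only [Pi.sub_apply]
      ring
    have h3 := abs_sub_abs_le_abs_sub (∑ i, boolSign (τ i) * (f (w i).1 - f (w i).2))
      (∑ i, boolSign (τ i) * (b (w i).1 - b (w i).2))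
    linarith
  have hb1 : ∀ b ∈ B, ((Finset.univ.filter fun τ : Fin n → Bool =>
      n * (ε / 4) ≤ |∑ i, boolSign (τ i) * (b (w i).1 - b (w i).2)|).card : ℝ) ≤
      2 * (2 ^ n * Real.exp (-(n * ε ^ 2 / 32))) := by
    intro b hb
    have ha : ∀ i, |b (w i).1 - b (w i).2| ≤ 1 := by
      intro i
      have h1 := hF1 b (hBF hb) (w i).1
      have h2 := hF1 b (hBF hb) (w i).2
      rw [abs_le]
      constructor <;> linarith [h1.1, h1.2, h2.1, h2.2]
    refine (card_le_abs_sum_boolSign ha (by positivity)).trans (le_of_eq ?_)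
    congr 3
    ring
  have h4 := (Finset.card_le_card hsub).trans Finset.card_biUnion_le
  calc ((Finset.univ.filter fun τ : Fin n → Bool =>
      ∃ f ∈ F, n * ε / 2 < |∑ i, (f (swapPairs τ w i).1 - f (swapPairs τ w i).2)|).card : ℝ)
      ≤ ∑ b ∈ B, ((Finset.univ.filter fun τ : Fin n → Bool =>
        n * (ε / 4) ≤ |∑ i, boolSign (τ i) * (b (w i).1 - b (w i).2)|).card : ℝ) := by
        exact_mod_cast h4
    _ ≤ ∑ _b ∈ B, 2 * (2 ^ n * Real.exp (-(n * ε ^ 2 / 32))) := Finset.sum_le_sum hb1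
    _ = B.card * (2 * (2 ^ n * Real.exp (-(n * ε ^ 2 / 32)))) := by
        rw [Finset.sum_const, nsmul_eq_mul]
    _ ≤ N * (2 * (2 ^ n * Real.exp (-(n * ε ^ 2 / 32)))) := by gcongr
    _ = 2 ^ n * (2 * N * Real.exp (-(n * ε ^ 2 / 32))) := by ring

/-- The measure of a set is an average over a group of sign changes, hence bounded by the largest
proportion of signs. -/
theorem measure_pi_le_of_forall_card_swapPairs_le {X : Type*} [MeasurableSpace X] (P : Measure X)
    [IsProbabilityMeasure P] {n : ℕ} {D : Set (Fin n → X × X)}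
    (hD : NullMeasurableSet D (Measure.pi fun _ : Fin n => P.prod P)) {c : ℝ}
    [∀ w, DecidablePred fun τ : Fin n → Bool => swapPairs τ w ∈ D]
    (hc : ∀ w, ((Finset.univ.filter fun τ : Fin n → Bool => swapPairs τ w ∈ D).card : ℝ) ≤
      2 ^ n * c) :
    (Measure.pi fun _ : Fin n => P.prod P) D ≤ ENNReal.ofReal c := by
  set ρ : Measure (Fin n → X × X) := Measure.pi fun _ : Fin n => P.prod P with hρ
  have hτ : ∀ τ : Fin n → Bool, NullMeasurableSet (swapPairs τ ⁻¹' D) ρ := fun τ =>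
    hD.preimage (measurePreserving_swapPairs P τ).quasiMeasurePreserving
  have hsum : (2 : ℝ≥0∞) ^ n * ρ D =
      ∫⁻ w, ∑ τ : Fin n → Bool, (swapPairs τ ⁻¹' D).indicator 1 w ∂ρ := by
    rw [lintegral_finsetSum' _ fun τ _ =>
      (measurable_one.aemeasurable (μ := ρ)).indicator₀ (hτ τ)]
    have : ∀ τ : Fin n → Bool, ∫⁻ w, (swapPairs τ ⁻¹' D).indicator 1 w ∂ρ = ρ D := fun τ => by
      rw [lintegral_indicator_one₀ (hτ τ), (measurePreserving_swapPairs P τ).measure_preimage hD]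
    simp only [this, Finset.sum_const, Finset.card_univ, Fintype.card_fun, Fintype.card_bool,
      Fintype.card_fin, nsmul_eq_mul]
    push_cast
    rfl
  have hbound : (2 : ℝ≥0∞) ^ n * ρ D ≤ 2 ^ n * ENNReal.ofReal c := by
    rw [hsum]
    calc ∫⁻ w, ∑ τ : Fin n → Bool, (swapPairs τ ⁻¹' D).indicator 1 w ∂ρ
        ≤ ∫⁻ _w, 2 ^ n * ENNReal.ofReal c ∂ρ := by
          refine lintegral_mono fun w => ?_
          have h1 : ∑ τ : Fin n → Bool, (swapPairs τ ⁻¹' D).indicator (1 : (Fin n → X × X) → ℝ≥0∞) w =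
              ((Finset.univ.filter fun τ : Fin n → Bool => swapPairs τ w ∈ D).card : ℝ≥0∞) := by
            rw [Finset.card_filter]
            push_cast
            refine Finset.sum_congr rfl fun τ _ => ?_
            simp [indicator]
          change ∑ τ : Fin n → Bool, (swapPairs τ ⁻¹' D).indicator (1 : (Fin n → X × X) → ℝ≥0∞) w ≤ _
          rw [h1, ← ENNReal.ofReal_natCast]
          refine (ENNReal.ofReal_le_ofReal (hc w)).trans (le_of_eq ?_)
          rw [ENNReal.ofReal_mul (by positivity), ENNReal.ofReal_pow zero_le_two,
            ENNReal.ofReal_ofNat]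
      _ = 2 ^ n * ENNReal.ofReal c := by simp
  exact (ENNReal.mul_le_mul_iff_right (by simp) (by simp)).1 hbound

/-- Chebyshev: a `[0,1]`-valued variable has variance at most `1/4`, so the probability is at most
`1/(nε²) ≤ 1/2`. -/
theorem measure_pi_half_le_abs_integral_sub_le {X : Type*} [MeasurableSpace X] (P : Measure X)
    [IsProbabilityMeasure P] {f : X → ℝ} (hf : Measurable f) (hf1 : ∀ x, f x ∈ Icc (0 : ℝ) 1)
    {ε : ℝ} (hε : 0 < ε) {n : ℕ} (hn : 2 ≤ n * ε ^ 2) :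
    (Measure.pi fun _ : Fin n => P) {z | ε / 2 ≤ |∫ x, f x ∂P - (∑ i, f (z i)) / n|} ≤
      ENNReal.ofReal (1 / 2) := by
  have hn0 : (0 : ℝ) < n := by
    by_contra! h
    have : (n : ℝ) * ε ^ 2 ≤ 0 := mul_nonpos_of_nonpos_of_nonneg h (sq_nonneg _)
    linarith
  have hL2 : MemLp f 2 P := MemLp.of_bound hf.aestronglyMeasurable 1 (by
    filter_upwards with x
    rw [Real.norm_eq_abs, abs_le]
    constructor <;> linarith [(hf1 x).1, (hf1 x).2])
  have hL2' : ∀ i : Fin n, MemLp (fun z : Fin n → X => f (z i)) 2 (Measure.pi fun _ : Fin n => P) :=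
    fun i => hL2.comp_measurePreserving (measurePreserving_eval (fun _ : Fin n => P) i)
  have hvar : Var[∑ i, fun z : Fin n → X => f (z i); Measure.pi fun _ : Fin n => P] ≤ n / 4 := by
    rw [variance_sum_pi (X := fun _ => f) (fun _ => hL2), Finset.sum_const, Finset.card_univ,
      Fintype.card_fin, nsmul_eq_mul]
    have := variance_le_sq_of_bounded (μ := P) (ae_of_all _ hf1) hf.aemeasurable
    nlinarith
  have hint : ∫ z, (∑ i, fun z : Fin n → X => f (z i)) z ∂(Measure.pi fun _ : Fin n => P) =
      n * ∫ x, f x ∂P := by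
    simp only [Finset.sum_apply]
    rw [integral_finsetSum _ fun i _ => (hL2' i).integrable one_le_two]
    have : ∀ i : Fin n, ∫ z : Fin n → X, f (z i) ∂(Measure.pi fun _ : Fin n => P) =
        ∫ x, f x ∂P := fun i =>
      integral_comp_eval (μ := fun _ : Fin n => P) (i := i) hf.aestronglyMeasurable
    simp [this]
  have hcheb := meas_ge_le_variance_div_sq (memLp_finsetSum' Finset.univ fun i _ => hL2' i)
    (c := n * (ε / 2)) (by positivity)
  rw [hint] at hcheb
  refine (measure_mono ?_).trans (hcheb.trans (ENNReal.ofReal_le_ofReal ?_))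
  · intro z hz
    change ε / 2 ≤ |∫ x, f x ∂P - (∑ i, f (z i)) / n| at hz
    change n * (ε / 2) ≤ |(∑ i, fun z : Fin n → X => f (z i)) z - n * ∫ x, f x ∂P|
    rw [Finset.sum_apply, abs_sub_comm]
    have : n * ∫ x, f x ∂P - ∑ i, f (z i) = n * (∫ x, f x ∂P - (∑ i, f (z i)) / n) := by
      field_simp
    rw [this, abs_mul, abs_of_pos hn0]
    gcongr
  · rw [div_le_iff₀ (by positivity)]
    refine hvar.trans ?_
    nlinarith

/-- Symmetrization by a ghost sample. -/
theorem measure_pi_exists_lt_le_two_mul {X : Type*} [MeasurableSpace X] (P : Measure X)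
    [IsProbabilityMeasure P] {F : Set (X → ℝ)} (hF1 : ∀ f ∈ F, ∀ x, f x ∈ Icc (0 : ℝ) 1)
    (hFm : ∀ f ∈ F, Measurable f) {ε : ℝ} (hε : 0 < ε) {n : ℕ} (hn : 2 ≤ n * ε ^ 2) :
    (Measure.pi fun _ : Fin n => P) {z | ∃ f ∈ F, ε < |∫ x, f x ∂P - (∑ i, f (z i)) / n|} ≤
      2 * (Measure.pi fun _ : Fin n => P.prod P)
        {w | ∃ f ∈ F, n * ε / 2 < |∑ i, (f (w i).1 - f (w i).2)|} := by
  have hn0 : (0 : ℝ) < n := by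
    by_contra! h
    have : (n : ℝ) * ε ^ 2 ≤ 0 := mul_nonpos_of_nonpos_of_nonneg h (sq_nonneg _)
    linarith
  set ρ : Measure (Fin n → X) := Measure.pi fun _ : Fin n => P with hρ
  let D : Set ((Fin n → X) × (Fin n → X)) :=
    {q | ∃ f ∈ F, n * ε / 2 < |∑ i, (f (q.1 i) - f (q.2 i))|}
  have hD : (Measure.pi fun _ : Fin n => P.prod P)
      {w | ∃ f ∈ F, n * ε / 2 < |∑ i, (f (w i).1 - f (w i).2)|} = (ρ.prod ρ) D :=
    (measurePreserving_arrowProdEquivProdArrow X X (Fin n) (fun _ => P)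
      (fun _ => P)).measure_preimage_equiv D
  rw [hD, ← measure_toMeasurable D]
  have hDm : MeasurableSet (toMeasurable (ρ.prod ρ) D) := measurableSet_toMeasurable _ _
  -- For the `f` violated by `z`, at least half of the ghost samples have error below `ε/2`, and
  -- each of these puts the pair in `D`. Markov's inequality for the section measure then applies,
  -- with a measurable hull in place of `D`.
  have hsub : {z | ∃ f ∈ F, ε < |∫ x, f x ∂P - (∑ i, f (z i)) / n|} ⊆
      {z | (2 : ℝ≥0∞)⁻¹ ≤ ρ (Prod.mk z ⁻¹' toMeasurable (ρ.prod ρ) D)} := by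
    rintro z ⟨f, hf, hz⟩
    have hcheb := measure_pi_half_le_abs_integral_sub_le P (hFm f hf) (hF1 f hf) hε hn
    have hfm := hFm f hf
    have hbad : MeasurableSet {z' : Fin n → X | ε / 2 ≤ |∫ x, f x ∂P - (∑ i, f (z' i)) / n|} :=
      measurableSet_le measurable_const (by fun_prop)
    have hgood : (2 : ℝ≥0∞)⁻¹ ≤
        ρ {z' : Fin n → X | ε / 2 ≤ |∫ x, f x ∂P - (∑ i, f (z' i)) / n|}ᶜ := by
      rw [prob_compl_eq_one_sub hbad]
      have h2 : ENNReal.ofReal (1 / 2) = 2⁻¹ := by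
        rw [one_div, ENNReal.ofReal_inv_of_pos two_pos, ENNReal.ofReal_ofNat]
      rw [h2] at hcheb
      calc (2 : ℝ≥0∞)⁻¹ = 1 - 2⁻¹ := ENNReal.one_sub_inv_two.symm
        _ ≤ _ := tsub_le_tsub_left hcheb 1
    refine hgood.trans (measure_mono fun z' hz' => subset_toMeasurable _ _ ?_)
    have hz'' : |∫ x, f x ∂P - (∑ i, f (z' i)) / n| < ε / 2 := not_le.1 hz'
    refine ⟨f, hf, ?_⟩
    have h1 : ∑ i, (f (z i) - f (z' i)) =
        n * ((∫ x, f x ∂P - (∑ i, f (z' i)) / n) - (∫ x, f x ∂P - (∑ i, f (z i)) / n)) := by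
      rw [Finset.sum_sub_distrib]
      field_simp
      ring
    change n * ε / 2 < |∑ i, (f (z i) - f (z' i))|
    rw [h1, abs_mul, abs_of_pos hn0, mul_div_assoc]
    gcongr
    rw [abs_sub_comm]
    have := abs_sub_abs_le_abs_sub (∫ x, f x ∂P - (∑ i, f (z i)) / n)
      (∫ x, f x ∂P - (∑ i, f (z' i)) / n)
    linarith
  have hmarkov := mul_meas_ge_le_lintegral (μ := ρ)
    (measurable_measure_prodMk_left (ν := ρ) hDm) (2 : ℝ≥0∞)⁻¹
  rw [← Measure.prod_apply hDm] at hmarkov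
  calc ρ {z | ∃ f ∈ F, ε < |∫ x, f x ∂P - (∑ i, f (z i)) / n|}
      ≤ ρ {z | (2 : ℝ≥0∞)⁻¹ ≤ ρ (Prod.mk z ⁻¹' toMeasurable (ρ.prod ρ) D)} := measure_mono hsub
    _ = 2 * (2⁻¹ * ρ {z | (2 : ℝ≥0∞)⁻¹ ≤ ρ (Prod.mk z ⁻¹' toMeasurable (ρ.prod ρ) D)}) := by
        rw [← mul_assoc, ENNReal.mul_inv_cancel two_ne_zero ENNReal.ofNat_ne_top, one_mul]
    _ ≤ 2 * (ρ.prod ρ) (toMeasurable (ρ.prod ρ) D) := by gcongr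

/-- The uniform deviation inequality for a class of functions with uniformly bounded covering
numbers. -/
theorem measure_pi_exists_lt_le {X : Type*} [MeasurableSpace X] (P : Measure X)
    [IsProbabilityMeasure P] {F : Set (X → ℝ)} (hF1 : ∀ f ∈ F, ∀ x, f x ∈ Icc (0 : ℝ) 1)
    (hFm : ∀ f ∈ F, Measurable f) {ε N : ℝ} (hε : 0 < ε) (hN : 1 ≤ N) {n : ℕ} (hn : 1 ≤ n)
    (hD : NullMeasurableSet {w | ∃ f ∈ F, n * ε / 2 < |∑ i, (f (w i).1 - f (w i).2)|}
      (Measure.pi fun _ : Fin n => P.prod P))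
    (hcov : ∀ Q : Measure X, IsProbabilityMeasure Q → ∃ B : Finset (X → ℝ),
      (B : Set (X → ℝ)) ⊆ F ∧ (B.card : ℝ) ≤ N ∧
        ∀ f ∈ F, ∃ b ∈ B, eLpNorm (f - b) 1 Q < ENNReal.ofReal (ε / 8)) :
    (Measure.pi fun _ : Fin n => P) {z | ∃ f ∈ F, ε < |∫ x, f x ∂P - (∑ i, f (z i)) / n|} ≤
      ENNReal.ofReal (4 * N * Real.exp (-(n * ε ^ 2 / 32))) := by
  classical
  -- For `nε² < 2`, where the Chebyshev step is unavailable, the claimed bound exceeds 1.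
  rcases lt_or_ge ((n : ℝ) * ε ^ 2) 2 with hsmall | hlarge
  · refine prob_le_one.trans (ENNReal.one_le_ofReal.2 ?_)
    have h1 := Real.add_one_le_exp (-(n * ε ^ 2 / 32))
    nlinarith
  refine (measure_pi_exists_lt_le_two_mul P hF1 hFm hε hlarge).trans ?_
  have h := measure_pi_le_of_forall_card_swapPairs_le P hD
    (c := 2 * N * Real.exp (-(n * ε ^ 2 / 32))) fun w => by
      have := isProbabilityMeasure_pairsEmpirical hn w
      obtain ⟨B, hBF, hBN, hB⟩ := hcov (pairsEmpirical w) this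
      exact card_exists_lt_abs_sum_swapPairs_le hF1 hFm hε hn w hBF hBN hB
  calc 2 * _ ≤ 2 * ENNReal.ofReal (2 * N * Real.exp (-(n * ε ^ 2 / 32))) := by gcongr
    _ = ENNReal.ofReal (4 * N * Real.exp (-(n * ε ^ 2 / 32))) := by
        rw [show (2 : ℝ≥0∞) = ENNReal.ofReal 2 by simp, ← ENNReal.ofReal_mul zero_le_two]
        congr 1
        ring

/-! ### Uniform deviations of the empirical risk -/

theorem IsPermissible.measurable {S : Type*} [MeasurableSpace S] {F : Set (S → ℝ)}
    (hF : IsPermissible F) {g : S → ℝ} (hg : g ∈ F) : Measurable g := by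
  obtain ⟨M, _, _, _, _, T, f, -, hf, rfl⟩ := hF
  obtain ⟨t, rfl⟩ := hg
  exact hf.comp (measurable_id.prodMk measurable_const)

/-- The deviation is jointly measurable in the sample and the parameter, so measurable projection
removes the quantifier over the class. -/
theorem IsPermissible.nullMeasurableSet_deviation {S : Type*} [MeasurableSpace S]
    {F : Set (S → ℝ)} (hF : IsPermissible F) {n : ℕ}
    (ρ : Measure (Fin n → (S × I) × (S × I))) [IsFiniteMeasure ρ] (c : ℝ) :
    NullMeasurableSet {w | ∃ f ∈ lossClass F, c < |∑ i, (f (w i).1 - f (w i).2)|} ρ := by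
  obtain ⟨M, _, _, _, _, T, f, hT, hf, rfl⟩ := hF
  have hmeas : MeasurableSet {q : (Fin n → (S × I) × (S × I)) × T |
      c < |∑ i, (loss (fun x => f x q.2) (q.1 i).1 - loss (fun x => f x q.2) (q.1 i).2)|} := by
    refine measurableSet_lt measurable_const (Measurable.abs (Finset.measurable_sum _ fun i _ => ?_))
    have h1 : Measurable fun q : (Fin n → (S × I) × (S × I)) × T => f (q.1 i).1.1 q.2 :=
      hf.comp (by fun_prop : Measurable fun q : (Fin n → (S × I) × (S × I)) × T =>
        ((q.1 i).1.1, q.2))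
    have h2 : Measurable fun q : (Fin n → (S × I) × (S × I)) × T => f (q.1 i).2.1 q.2 :=
      hf.comp (by fun_prop : Measurable fun q : (Fin n → (S × I) × (S × I)) × T =>
        ((q.1 i).2.1, q.2))
    have h3 : Measurable fun q : (Fin n → (S × I) × (S × I)) × T => ((q.1 i).1.2 : ℝ) :=
      measurable_subtype_coe.comp (by fun_prop)
    have h4 : Measurable fun q : (Fin n → (S × I) × (S × I)) × T => ((q.1 i).2.2 : ℝ) :=
      measurable_subtype_coe.comp (by fun_prop)
    exact ((h1.sub h3).pow_const 2).sub ((h2.sub h4).pow_const 2)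
  convert nullMeasurableSet_exists ρ hT (p := fun w t =>
    c < |∑ i, (loss (fun x => f x t) (w i).1 - loss (fun x => f x t) (w i).2)|) hmeas using 1
  ext w
  simp [lossClass]

theorem measurable_of_mem_lossClass {S : Type*} [MeasurableSpace S] {F : Set (S → ℝ)}
    (hF : IsPermissible F) {f : S × I → ℝ} (hf : f ∈ lossClass F) : Measurable f := by
  obtain ⟨g, hg, rfl⟩ := hf
  exact measurable_loss (hF.measurable hg)

theorem mem_Icc_of_mem_lossClass {S : Type*} {F : Set (S → ℝ)}
    (hF1 : ∀ g ∈ F, ∀ x, g x ∈ Icc (0 : ℝ) 1) {f : S × I → ℝ} (hf : f ∈ lossClass F)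
    (z : S × I) : f z ∈ Icc (0 : ℝ) 1 := by
  obtain ⟨g, hg, rfl⟩ := hf
  exact loss_mem_Icc (hF1 g hg) z

section Deviation

variable {S Ω : Type*} [MeasurableSpace S] [MeasurableSpace Ω] {F : Set (S → ℝ)}
  {P : Measure (S × I)} [IsProbabilityMeasure P] {μ : Measure Ω} [IsProbabilityMeasure μ]
  {Z : ℕ → Ω → S × I}

/-- The uniform deviation inequality for an i.i.d. sample, with a bound for the covering numbers of
the loss class. -/
theorem measure_exists_lt_abs_risk_sub_le_of_cover
    (hF1 : ∀ g ∈ F, ∀ x, g x ∈ Icc (0 : ℝ) 1) (hF : IsPermissible F)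
    (hZ : ∀ i, HasLaw (Z i) P μ) (hind : iIndepFun Z μ) {ε N : ℝ} (hε : 0 < ε) (hN : 1 ≤ N)
    {n : ℕ} (hn : 1 ≤ n)
    (hcov : ∀ Q : Measure (S × I), IsProbabilityMeasure Q → ∃ B : Finset (S × I → ℝ),
      (B : Set (S × I → ℝ)) ⊆ lossClass F ∧ (B.card : ℝ) ≤ N ∧
        ∀ f ∈ lossClass F, ∃ b ∈ B, eLpNorm (f - b) 1 Q < ENNReal.ofReal (ε / 8)) :
    μ {ω | ∃ g ∈ F, ε < |risk P g - empRisk n (fun i => Z i ω) g|} ≤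
      ENNReal.ofReal (4 * N * Real.exp (-(n * ε ^ 2 / 32))) := by
  have hmain := measure_pi_exists_lt_le P (fun f hf => mem_Icc_of_mem_lossClass hF1 hf)
    (fun f hf => measurable_of_mem_lossClass hF hf) hε hN hn
    (hF.nullMeasurableSet_deviation _ _) hcov
  have hae : ∀ i : Fin n, AEMeasurable (Z i) μ := fun i => (hZ i).aemeasurable
  have hmap : μ.map (fun ω (i : Fin n) => Z i ω) = Measure.pi fun _ : Fin n => P := by
    have h1 : iIndepFun (fun i : Fin n => Z i) μ := hind.precomp Fin.val_injective
    rw [(iIndepFun_iff_map_fun_eq_pi_map hae).1 h1]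
    congr 1
    ext1 i
    exact (hZ i).map_eq
  rw [← hmap] at hmain
  refine le_trans ?_ hmain
  -- `Measure.le_map_apply` holds for arbitrary sets, so the event on the sample need not be
  -- measurable.
  refine le_trans (measure_mono ?_)
    (Measure.le_map_apply (aemeasurable_pi_lambda _ hae) _)
  rintro ω ⟨g, hg, hlt⟩
  refine ⟨loss g, mem_image_of_mem _ hg, ?_⟩
  rw [empRisk, Finset.sum_range] at hlt
  exact hlt

/-- The uniform deviation inequality for VC subgraph classes of positive dimension. -/
theorem measure_exists_lt_abs_risk_sub_le
    (hF1 : ∀ g ∈ F, ∀ x, g x ∈ Icc (0 : ℝ) 1) (hF : IsPermissible F) (hVC : IsVCSubgraph F)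
    (hV : 1 ≤ subgraphDim F) (hZ : ∀ i, HasLaw (Z i) P μ) (hind : iIndepFun Z μ) {ε : ℝ}
    (hε0 : 0 < ε) (hε1 : ε < 1) {n : ℕ} (hn : 1 ≤ n) :
    μ {ω | ∃ g ∈ F, ε < |risk P g - empRisk n (fun i => Z i ω) g|} ≤
      ENNReal.ofReal (8 * (2 * subgraphDim F) * (128 * Real.exp 1 / ε) ^ (2 * subgraphDim F) *
        Real.exp (-(n * ε ^ 2 / 128))) := by
  have he : (1 : ℝ) ≤ Real.exp 1 := Real.one_le_exp zero_le_one
  have hV' : (1 : ℝ) ≤ subgraphDim F := by exact_mod_cast hV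
  -- A cover at radius `ε/8` has at most `(64e/ε) ^ (2V)` members; the stated constants leave room.
  have hbase : 1 ≤ 8 * Real.exp 1 / (ε / 8) := by
    rw [le_div_iff₀ (by positivity)]
    linarith
  refine (measure_exists_lt_abs_risk_sub_le_of_cover hF1 hF hZ hind hε0
    (one_le_pow₀ hbase (n := 2 * subgraphDim F)) hn fun Q _ =>
      exists_cover_lossClass hF1 (fun g hg => hF.measurable hg) hVC hV Q (by positivity)
        (by linarith)).trans (ENNReal.ofReal_le_ofReal ?_)
  gcongr ?_ * ?_ * ?_
  · linarith
  · refine pow_le_pow_left₀ (by positivity) ?_ _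
    rw [div_div_eq_mul_div, mul_right_comm]
    gcongr
    norm_num
  · refine Real.exp_le_exp.2 (neg_le_neg ?_)
    gcongr
    norm_num

/-- The deviation inequality for VC subgraph classes of dimension zero. -/
theorem measure_exists_lt_abs_risk_sub_le_of_subgraphDim_eq_zero
    (hF1 : ∀ g ∈ F, ∀ x, g x ∈ Icc (0 : ℝ) 1) (hF : IsPermissible F) (hVC : IsVCSubgraph F)
    (hV : subgraphDim F = 0) (hZ : ∀ i, HasLaw (Z i) P μ) (hind : iIndepFun Z μ) {ε : ℝ}
    (hε0 : 0 < ε) {n : ℕ} (hn : 1 ≤ n) :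
    μ {ω | ∃ g ∈ F, ε < |risk P g - empRisk n (fun i => Z i ω) g|} ≤
      ENNReal.ofReal (4 * Real.exp (-(n * ε ^ 2 / 32))) := by
  have hss : (lossClass F).Subsingleton := (subsingleton_of_subgraphDim_eq_zero hVC hV).image _
  have hcard : hss.finite.toFinset.card ≤ 1 :=
    Finset.card_le_one.2 fun a ha b hb => hss (by simpa using ha) (by simpa using hb)
  have h := measure_exists_lt_abs_risk_sub_le_of_cover hF1 hF hZ hind hε0 le_rfl hn fun Q _ =>
    ⟨hss.finite.toFinset, by simp, by exact_mod_cast hcard, fun f hf =>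
      ⟨f, by simpa using hf, by simp [hε0]⟩⟩
  rwa [mul_one] at h

end Deviation

/-! ### Strong consistency -/

theorem abs_risk_sub_empRisk_le_one {S : Type*} [MeasurableSpace S] (P : Measure (S × I))
    [IsProbabilityMeasure P] {g : S → ℝ} (hg1 : ∀ x, g x ∈ Icc (0 : ℝ) 1) (n : ℕ)
    (z : ℕ → S × I) : |risk P g - empRisk n z g| ≤ 1 := by
  have h1 : 0 ≤ risk P g := integral_nonneg fun z => (loss_mem_Icc hg1 z).1
  have h2 : risk P g ≤ 1 := by
    have : risk P g ≤ ∫ _, (1 : ℝ) ∂P :=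
      integral_mono_of_nonneg (ae_of_all _ fun z => (loss_mem_Icc hg1 z).1)
        (integrable_const _) (ae_of_all _ fun z => (loss_mem_Icc hg1 z).2)
    simpa using this
  have h3 : 0 ≤ empRisk n z g :=
    div_nonneg (Finset.sum_nonneg fun i _ => (loss_mem_Icc hg1 (z i)).1) (Nat.cast_nonneg n)
  have h4 : empRisk n z g ≤ 1 := by
    refine div_le_one_of_le₀ ?_ (Nat.cast_nonneg n)
    calc ∑ i ∈ Finset.range n, loss g (z i) ≤ ∑ _i ∈ Finset.range n, (1 : ℝ) :=
          Finset.sum_le_sum fun i _ => (loss_mem_Icc hg1 (z i)).2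
      _ = n := by simp
  rw [abs_le]
  constructor <;> linarith

theorem one_le_log_penalty {n : ℕ} (hn : 1 ≤ n) :
    1 ≤ Real.log (128 * Real.exp 1 ^ 2 * n) := by
  have hn' : (1 : ℝ) ≤ n := by exact_mod_cast hn
  have he : (1 : ℝ) ≤ Real.exp 1 := Real.one_le_exp zero_le_one
  rw [Real.le_log_iff_exp_le (by positivity)]
  nlinarith [mul_le_mul he hn' zero_le_one (by linarith), mul_pos (Real.exp_pos 1) (Real.exp_pos 1)]

theorem penalty_sq {S : Type*} (G : ℕ → Set (S → ℝ)) {n : ℕ} (hn : 1 ≤ n) (j : ℕ) :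
    penalty G n j ^ 2 =
      256 * (subgraphDim (G j) : ℝ) * Real.log (128 * Real.exp 1 ^ 2 * n) / n := by
  have := one_le_log_penalty hn
  exact Real.sq_sqrt (by positivity)

theorem tendsto_penalty {S : Type*} (G : ℕ → Set (S → ℝ)) (j : ℕ) :
    Tendsto (fun n => penalty G n j) atTop (𝓝 0) := by
  have hc : 0 < 128 * Real.exp 1 ^ 2 := by positivity
  have h1 : Tendsto (fun n : ℕ => 128 * Real.exp 1 ^ 2 * (n : ℝ)) atTop atTop :=
    tendsto_natCast_atTop_atTop.const_mul_atTop hc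
  -- The coefficient `(128e²)⁻¹` turns the denominator, evaluated at `128e²n`, into `n`.
  have h2 := (Real.tendsto_pow_log_div_mul_add_atTop (128 * Real.exp 1 ^ 2)⁻¹ 0 1
    (inv_ne_zero hc.ne')).comp h1
  have h3 := (h2.const_mul (256 * (subgraphDim (G j) : ℝ))).sqrt
  rw [mul_zero, Real.sqrt_zero] at h3
  refine h3.congr fun n => ?_
  simp only [Function.comp_apply, pow_one, add_zero, penalty]
  rw [inv_mul_cancel_left₀ hc.ne', mul_div_assoc]

section Consistency

variable {S Ω : Type*} [MeasurableSpace S] [MeasurableSpace Ω] {G : ℕ → Set (S → ℝ)}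
  {P : Measure (S × I)} [IsProbabilityMeasure P] {μ : Measure Ω} [IsProbabilityMeasure μ]
  {Z : ℕ → Ω → S × I}

/-- The probability that the deviations over one class exceed the penalty. -/
theorem measure_exists_add_penalty_lt_le (hG1 : ∀ j, ∀ g ∈ G j, ∀ x, g x ∈ Icc (0 : ℝ) 1)
    (hG : ∀ j, IsPermissible (G j)) (hVC : ∀ j, IsVCSubgraph (G j))
    (hZ : ∀ i, HasLaw (Z i) P μ) (hind : iIndepFun Z μ) {ε : ℝ} (hε : 0 < ε) {n : ℕ}
    (hn : 1 ≤ n) (j : ℕ) :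
    μ {ω | ∃ g ∈ G j, ε + penalty G n j < |risk P g - empRisk n (fun i => Z i ω) g|} ≤
      ENNReal.ofReal (16 * Real.exp (-(subgraphDim (G j) : ℝ)) *
        Real.exp (-(n * ε ^ 2 / 128))) := by
  have hn0 : (0 : ℝ) < n := by exact_mod_cast hn
  have hn1 : (1 : ℝ) ≤ n := by exact_mod_cast hn
  rcases Nat.eq_zero_or_pos (subgraphDim (G j)) with hV | hV
  · have hpen : penalty G n j = 0 := by simp [penalty, hV]
    rw [hpen, add_zero, hV]
    refine (measure_exists_lt_abs_risk_sub_le_of_subgraphDim_eq_zero (hG1 j) (hG j) (hVC j) hV hZ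
      hind hε hn).trans (ENNReal.ofReal_le_ofReal ?_)
    rw [Nat.cast_zero, neg_zero, Real.exp_zero, mul_one]
    gcongr
    · norm_num
    · norm_num
  set V : ℕ := subgraphDim (G j) with hVdef
  set r : ℝ := penalty G n j with hr
  have hV1 : (1 : ℝ) ≤ V := by exact_mod_cast hV
  have hlog := one_le_log_penalty hn
  set l : ℝ := Real.log (128 * Real.exp 1 ^ 2 * n) with hl
  have hr0 : 0 ≤ r := Real.sqrt_nonneg _
  have hrsq : r ^ 2 = 256 * V * l / n := penalty_sq G hn j
  -- The deviation inequality requires a level below 1; from 1 on the event is empty, both risks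
  -- lying in `[0,1]`.
  rcases le_or_gt 1 (ε + r) with hbig | hlt
  · have hempty : {ω | ∃ g ∈ G j, ε + r < |risk P g - empRisk n (fun i => Z i ω) g|} = ∅ := by
      refine eq_empty_of_forall_notMem ?_
      rintro ω ⟨g, hg, h⟩
      have := abs_risk_sub_empRisk_le_one P (hG1 j g hg) n (fun i => Z i ω)
      linarith
    rw [hempty, measure_empty]
    exact zero_le
  have hη0 : 0 < ε + r := by linarith
  refine (measure_exists_lt_abs_risk_sub_le (hG1 j) (hG j) (hVC j) hV hZ hind hη0 hlt hn).trans
    (ENNReal.ofReal_le_ofReal ?_)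
  rw [← hVdef]
  -- This replaces the unknown level in `128e/(ε + r)` by the explicit `128en`.
  have hrn : 1 / n ≤ r := by
    refine le_of_sq_le_sq ?_ hr0
    rw [hrsq, div_pow, one_pow, div_le_div_iff₀ (by positivity) hn0]
    have : 1 ≤ 256 * V * l := by nlinarith
    nlinarith
  have hbase : 128 * Real.exp 1 / (ε + r) ≤ 128 * Real.exp 1 * n := by
    rw [div_le_iff₀ hη0]
    have h1 : 1 ≤ n * (ε + r) := by
      rw [div_le_iff₀ hn0] at hrn
      nlinarith
    have h2 : 0 < 128 * Real.exp 1 := by positivity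
    nlinarith
  -- Dropping the cross term of `(ε + r)²` splits the exponential; the factor from `r²` is exactly
  -- the inverse power.
  have hexp : Real.exp (-(n * (ε + r) ^ 2 / 128)) ≤
      Real.exp (-(n * ε ^ 2 / 128)) * ((128 * Real.exp 1 ^ 2 * n) ^ (2 * V))⁻¹ := by
    have h1 : ((128 * Real.exp 1 ^ 2 * n) ^ (2 * V))⁻¹ = Real.exp (-(n * r ^ 2 / 128)) := by
      rw [Real.exp_neg, hrsq, show (n : ℝ) * (256 * V * l / n) / 128 = ((2 * V : ℕ) : ℝ) * l by
        push_cast; field_simp; ring, Real.exp_nat_mul, hl, Real.exp_log (by positivity)]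
    rw [h1, ← Real.exp_add]
    refine Real.exp_le_exp.2 ?_
    have : 0 ≤ n * (2 * ε * r) := by positivity
    nlinarith
  have hVexp : (V : ℝ) ≤ Real.exp V := by linarith [Real.add_one_le_exp (V : ℝ)]
  have hratio : (128 * Real.exp 1 * n) ^ (2 * V) * ((128 * Real.exp 1 ^ 2 * n) ^ (2 * V))⁻¹ =
      Real.exp (-V) * Real.exp (-V) := by
    rw [← inv_pow, ← mul_pow, show 128 * Real.exp 1 * n * (128 * Real.exp 1 ^ 2 * n)⁻¹ =
      Real.exp (-1) by rw [Real.exp_neg]; field_simp, ← Real.exp_nat_mul, ← Real.exp_add]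
    congr 1
    push_cast
    ring
  calc 8 * (2 * (V : ℝ)) * (128 * Real.exp 1 / (ε + r)) ^ (2 * V) *
        Real.exp (-(n * (ε + r) ^ 2 / 128))
      ≤ 8 * (2 * (V : ℝ)) * (128 * Real.exp 1 * n) ^ (2 * V) *
        (Real.exp (-(n * ε ^ 2 / 128)) * ((128 * Real.exp 1 ^ 2 * n) ^ (2 * V))⁻¹) := by
        gcongr
    _ = 16 * (V * ((128 * Real.exp 1 * n) ^ (2 * V) * ((128 * Real.exp 1 ^ 2 * n) ^ (2 * V))⁻¹)) *
        Real.exp (-(n * ε ^ 2 / 128)) := by ring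
    _ = 16 * (V * Real.exp (-V) * Real.exp (-V)) * Real.exp (-(n * ε ^ 2 / 128)) := by
        rw [hratio, mul_assoc (V : ℝ)]
    _ ≤ 16 * (1 * Real.exp (-V)) * Real.exp (-(n * ε ^ 2 / 128)) := by
        gcongr
        calc V * Real.exp (-V) ≤ Real.exp V * Real.exp (-V) := by gcongr
          _ = 1 := by rw [← Real.exp_add, add_neg_cancel, Real.exp_zero]
    _ = _ := by rw [one_mul]

/-- Almost surely, all deviations are eventually controlled by the penalties. -/
theorem ae_eventually_forall_abs_risk_sub_le
    (hG1 : ∀ j, ∀ g ∈ G j, ∀ x, g x ∈ Icc (0 : ℝ) 1)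
    (hG : ∀ j, IsPermissible (G j)) (hVC : ∀ j, IsVCSubgraph (G j))
    (hZ : ∀ i, HasLaw (Z i) P μ) (hind : iIndepFun Z μ)
    (hsum : Summable fun j => Real.exp (-(subgraphDim (G j) : ℝ))) {ε : ℝ} (hε : 0 < ε) :
    ∀ᵐ ω ∂μ, ∀ᶠ n in atTop, ∀ j, ∀ g ∈ G j,
      |risk P g - empRisk n (fun i => Z i ω) g| ≤ ε + penalty G n j := by
  let bad : ℕ → Set Ω := fun n => ⋃ j,
    {ω | ∃ g ∈ G j, ε + penalty G n j < |risk P g - empRisk n (fun i => Z i ω) g|}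
  set C : ℝ := ∑' j, 16 * Real.exp (-(subgraphDim (G j) : ℝ)) with hC
  set q : ℝ := Real.exp (-(ε ^ 2 / 128)) with hq
  have hq1 : q < 1 := Real.exp_lt_one_iff.2 (neg_lt_zero.2 (by positivity))
  have hC0 : 0 ≤ C := tsum_nonneg fun j => by positivity
  have hbad : ∀ n, 1 ≤ n → μ (bad n) ≤ ENNReal.ofReal (C * q ^ n) := by
    intro n hn
    calc μ (bad n) ≤ ∑' j, ENNReal.ofReal (16 * Real.exp (-(subgraphDim (G j) : ℝ)) *
          Real.exp (-(n * ε ^ 2 / 128))) :=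
          (measure_iUnion_le _).trans (ENNReal.tsum_le_tsum fun j =>
            measure_exists_add_penalty_lt_le hG1 hG hVC hZ hind hε hn j)
      _ = ENNReal.ofReal (∑' j, 16 * Real.exp (-(subgraphDim (G j) : ℝ)) *
          Real.exp (-(n * ε ^ 2 / 128))) :=
          (ENNReal.ofReal_tsum_of_nonneg (fun j => by positivity)
            ((hsum.mul_left 16).mul_right _)).symm
      _ = ENNReal.ofReal (C * q ^ n) := by
          rw [tsum_mul_right, hC, hq, ← Real.exp_nat_mul]
          congr 3
          ring
  -- The index is shifted because the bound starts at `n = 1`.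
  have hfin : ∑' n, μ (bad (n + 1)) ≠ ∞ := by
    have hs : Summable fun n : ℕ => C * q ^ (n + 1) :=
      ((summable_nat_add_iff 1).2
        (summable_geometric_of_lt_one (Real.exp_pos _).le hq1)).mul_left C
    refine ne_top_of_le_ne_top ?_ (ENNReal.tsum_le_tsum fun n => hbad (n + 1) (by omega))
    rw [← ENNReal.ofReal_tsum_of_nonneg (fun n => by positivity) hs]
    exact ENNReal.ofReal_ne_top
  filter_upwards [ae_eventually_notMem hfin] with ω hω
  have hω' : ∀ᶠ n in atTop, ω ∉ bad n := by
    obtain ⟨N, hN⟩ := eventually_atTop.1 hω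
    refine eventually_atTop.2 ⟨N + 1, fun n hn => ?_⟩
    have := hN (n - 1) (by omega)
    rwa [Nat.sub_add_cancel (by omega)] at this
  filter_upwards [hω'] with n hn j g hg
  by_contra! hlt
  exact hn (mem_iUnion.2 ⟨j, g, hg, hlt⟩)

/-- Where deviations are controlled by `η + r(n, ·)`, the penalty of the selected class cancels, and
`L(g*) ≤ L(g) + 2η + 2r(n, j)` for every fixed `g ∈ G j`. Since `r(n, j) → 0`, a nearly optimal `g`
suffices. -/
theorem stronglyConsistent_of_isSRMEstimator
    (hG1 : ∀ j, ∀ g ∈ G j, ∀ x, g x ∈ Icc (0 : ℝ) 1)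
    (hG : ∀ j, IsPermissible (G j)) (hVC : ∀ j, IsVCSubgraph (G j))
    (hZ : ∀ i, HasLaw (Z i) P μ) (hind : iIndepFun Z μ)
    (hsum : Summable fun j => Real.exp (-(subgraphDim (G j) : ℝ)))
    (hbayes : bayesRisk P = ⨅ j, ⨅ g : G j, risk P g)
    {ghat : ℕ → ℕ → Ω → S → ℝ} {gstar : ℕ → Ω → S → ℝ}
    (hg : ∀ n, 1 ≤ n → ∀ ω, IsSRMEstimator G (penalty G) n (fun i => Z i ω)
      (fun j => ghat n j ω) (gstar n ω)) :
    StronglyConsistent P μ gstar := by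
  have hae : ∀ᵐ ω ∂μ, ∀ k : ℕ, ∀ᶠ n in atTop, ∀ j, ∀ g ∈ G j,
      |risk P g - empRisk n (fun i => Z i ω) g| ≤ 1 / ((k : ℝ) + 1) + penalty G n j :=
    ae_all_iff.2 fun k =>
      ae_eventually_forall_abs_risk_sub_le hG1 hG hVC hZ hind hsum (by positivity)
  filter_upwards [hae] with ω hω
  have hne : ∀ j, Nonempty (G j) := fun j => ⟨⟨_, ((hg 1 le_rfl ω).1 j).1⟩⟩
  have hrisk0 : ∀ g, 0 ≤ risk P g := fun g => integral_nonneg fun z => sq_nonneg _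
  have hbdd : ∀ j, BddBelow (range fun g : G j => risk P g) := fun j =>
    ⟨0, by rintro _ ⟨g, rfl⟩; exact hrisk0 g⟩
  have hbdd' : BddBelow (range fun j => ⨅ g : G j, risk P g) :=
    ⟨0, by rintro _ ⟨j, rfl⟩; exact Real.iInf_nonneg fun g => hrisk0 g⟩
  have hlower : ∀ n, 1 ≤ n → bayesRisk P ≤ risk P (gstar n ω) := by
    intro n hn
    obtain ⟨hls, j, hj, -⟩ := hg n hn ω
    rw [hbayes, hj]
    exact (ciInf_le hbdd' j).trans (ciInf_le (hbdd j) ⟨_, (hls j).1⟩)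
  rw [Metric.tendsto_atTop']
  intro ε hε
  -- Five errors of size `ε/5`: two tolerances `1/(k+1)`, two penalties of class `j`, and the excess
  -- risk of `g`.
  obtain ⟨k, hk⟩ := exists_nat_one_div_lt (show 0 < ε / 5 by positivity)
  obtain ⟨j, hj⟩ : ∃ j, ⨅ g : G j, risk P g < bayesRisk P + ε / 5 :=
    exists_lt_of_ciInf_lt (by rw [← hbayes]; linarith)
  obtain ⟨⟨g, hgj⟩, hgr⟩ := exists_lt_of_ciInf_lt hj
  have hpen : ∀ᶠ n in atTop, penalty G n j < ε / 5 :=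
    (tendsto_penalty G j).eventually (gt_mem_nhds (by positivity))
  obtain ⟨N, hN⟩ := eventually_atTop.1 ((hω k).and (hpen.and (eventually_ge_atTop 1)))
  refine ⟨N, fun n hn => ?_⟩
  obtain ⟨hdev, hpn, hn1⟩ := hN n hn.le
  have hlow := hlower n hn1
  obtain ⟨hls, i, hi, hmin⟩ := hg n hn1 ω
  have h1 := hdev i (gstar n ω) (hi ▸ (hls i).1)
  have h2 := hmin j
  have h3 := (hls j).2 g hgj
  have h4 := hdev j g hgj
  rw [← hi] at h2
  rw [abs_le] at h1 h4
  rw [Real.dist_eq, abs_of_nonneg (by linarith)]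
  simp only at hgr
  linarith [h1.2, h4.1]

end Consistency

/-! ### Passage to covering numbers and suprema -/

theorem coveringNumber_lossClass_le {S : Type*} [MeasurableSpace S] {F : Set (S → ℝ)}
    (hF1 : ∀ g ∈ F, ∀ x, g x ∈ Icc (0 : ℝ) 1) (hF : IsPermissible F)
    (hVC : IsVCSubgraph F) (hV : 1 ≤ subgraphDim F) (Q : Measure (S × I))
    [IsProbabilityMeasure Q] {ε : ℝ} (hε0 : 0 < ε) (hε1 : ε < 1) :
    (coveringNumber 1 ε (lossClass F) Q : ℝ≥0∞) ≤
      ENNReal.ofReal (2 * subgraphDim F * (16 * Real.exp 1 / ε) ^ (2 * subgraphDim F)) := by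
  obtain ⟨B, hBF, hcard, hB⟩ :=
    exists_cover_lossClass hF1 (fun g hg => hF.measurable hg) hVC hV Q hε0 hε1
  have h1 : coveringNumber 1 ε (lossClass F) Q ≤ (B.card : ℕ∞) :=
    iInf_le (fun B : {B : Finset (S × I → ℝ) // (B : Set (S × I → ℝ)) ⊆ lossClass F ∧
      ∀ f ∈ lossClass F, ∃ b ∈ B, eLpNorm (f - b) 1 Q < ENNReal.ofReal ε} =>
        ((B : Finset (S × I → ℝ)).card : ℕ∞)) ⟨B, hBF, hB⟩
  have h2 : (coveringNumber 1 ε (lossClass F) Q : ℝ≥0∞) ≤ ((B.card : ℕ∞) : ℝ≥0∞) :=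
    ENat.toENNReal_le.2 h1
  refine h2.trans ?_
  rw [ENat.toENNReal_coe, ← ENNReal.ofReal_natCast]
  refine ENNReal.ofReal_le_ofReal (hcard.trans ?_)
  have hV' : (1 : ℝ) ≤ 2 * subgraphDim F := by
    have : (1 : ℝ) ≤ subgraphDim F := by exact_mod_cast hV
    linarith
  calc (8 * Real.exp 1 / ε) ^ (2 * subgraphDim F)
      ≤ (16 * Real.exp 1 / ε) ^ (2 * subgraphDim F) := by gcongr; norm_num
    _ ≤ _ := le_mul_of_one_le_left (by positivity) hV'

theorem measure_lt_iSup_abs_risk_sub_le {S Ω : Type*} [MeasurableSpace S] [MeasurableSpace Ω]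
    {F : Set (S → ℝ)} {P : Measure (S × I)} [IsProbabilityMeasure P] {μ : Measure Ω}
    [IsProbabilityMeasure μ] {Z : ℕ → Ω → S × I}
    (hF1 : ∀ g ∈ F, ∀ x, g x ∈ Icc (0 : ℝ) 1) (hF : IsPermissible F) (hVC : IsVCSubgraph F)
    (hV : 1 ≤ subgraphDim F) (hZ : ∀ i, HasLaw (Z i) P μ) (hind : iIndepFun Z μ) {ε : ℝ}
    (hε0 : 0 < ε) (hε1 : ε < 1) {n : ℕ} (hn : 1 ≤ n) :
    μ {ω | ε < ⨆ g : F, |risk P g - empRisk n (fun i => Z i ω) g|} ≤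
      ENNReal.ofReal (8 * (2 * subgraphDim F) * (128 * Real.exp 1 / ε) ^ (2 * subgraphDim F) *
        Real.exp (-(n * ε ^ 2 / 128))) := by
  refine le_trans (measure_mono fun ω hω => ?_)
    (measure_exists_lt_abs_risk_sub_le hF1 hF hVC hV hZ hind hε0 hε1 hn)
  have hω' : ε < ⨆ g : F, |risk P g - empRisk n (fun i => Z i ω) g| := hω
  -- The real supremum over an empty class is 0, which is not above `ε`.
  rcases isEmpty_or_nonempty F with hE | hE
  · rw [Real.iSup_of_isEmpty] at hω'
    exact absurd hω' (not_lt.2 hε0.le)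
  · obtain ⟨g, hg⟩ := exists_lt_of_lt_ciSup hω'
    exact ⟨g, g.2, hg⟩

end SRM

theorem corollary5p4 :
    ∃ K : ℝ, 0 < K ∧
      ∀ (S : Type*) [MeasurableSpace S] (G : ℕ → Set (S → ℝ)),
        (∀ j, ∀ g ∈ G j, ∀ x, g x ∈ Icc (0 : ℝ) 1) →
        (∀ j, SRM.IsPermissible (G j)) →
        (∀ j, SRM.IsVCSubgraph (G j)) →
        -- the covering bound for the loss classes
        (∀ j, 1 ≤ SRM.subgraphDim (G j) →
          ∀ (P : Measure (S × I)) [IsProbabilityMeasure P] (ε : ℝ), 0 < ε → ε < 1 →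
            (SRM.coveringNumber 1 ε (SRM.lossClass (G j)) P : ℝ≥0∞) ≤
              ENNReal.ofReal (K * (2 * SRM.subgraphDim (G j)) *
                (16 * Real.exp 1 / ε) ^ (2 * SRM.subgraphDim (G j)))) ∧
        -- an i.i.d. sample `Z 0, Z 1, …` from the law `P` of `(X, Y)`
        ∀ (P : Measure (S × I)) [IsProbabilityMeasure P]
          (Ω : Type*) [MeasurableSpace Ω] (μ : Measure Ω) [IsProbabilityMeasure μ]
          (Z : ℕ → Ω → S × I), (∀ i, HasLaw (Z i) P μ) → iIndepFun Z μ →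
          -- the uniform deviation bound
          (∀ j, 1 ≤ SRM.subgraphDim (G j) →
            ∀ n : ℕ, 1 ≤ n → ∀ ε : ℝ, 0 < ε → ε < 1 →
              μ {ω | ε < ⨆ g : G j, |SRM.risk P g - SRM.empRisk n (fun i => Z i ω) g|} ≤
                ENNReal.ofReal (8 * K * (2 * SRM.subgraphDim (G j)) *
                  (128 * Real.exp 1 / ε) ^ (2 * SRM.subgraphDim (G j)) *
                  Real.exp (-(n * ε ^ 2 / 128)))) ∧
          -- strong consistency
          (Summable (fun j => Real.exp (-(SRM.subgraphDim (G j) : ℝ))) →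
            SRM.bayesRisk P = (⨅ j, ⨅ g : G j, SRM.risk P g) →
            ∀ (ghat : ℕ → ℕ → Ω → S → ℝ) (gstar : ℕ → Ω → S → ℝ),
              (∀ n, 1 ≤ n → ∀ ω,
                SRM.IsSRMEstimator G (SRM.penalty G) n (fun i => Z i ω)
                  (fun j => ghat n j ω) (gstar n ω)) →
              SRM.StronglyConsistent P μ gstar) := by
  refine ⟨1, one_pos, fun S _ G hG1 hG hVC => ⟨fun j hV P _ ε hε0 hε1 => ?_,
    fun P _ Ω _ μ _ Z hZ hind => ⟨fun j hV n hn ε hε0 hε1 => ?_,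
      fun hsum hbayes ghat gstar hg => ?_⟩⟩⟩
  · rw [one_mul]
    exact SRM.coveringNumber_lossClass_le (hG1 j) (hG j) (hVC j) hV P hε0 hε1
  · rw [mul_one]
    exact SRM.measure_lt_iSup_abs_risk_sub_le (hG1 j) (hG j) (hVC j) hV hZ hind hε0 hε1 hn
  · exact SRM.stronglyConsistent_of_isSRMEstimator hG1 hG hVC hZ hind hsum hbayes hg
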